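/- Let $n \ge 0$ and let $S^{2n+1}$ be the unit sphere in $\mathbb{R}^{2n+2}$. An oriented great circle is the unit circle in an oriented $2$-plane through the origin of $\mathbb{R}^{2n+2}$. A smooth fibration by oriented great circles of an open set $U \subseteq S^{2n+1}$ is a family $\mathcal{F}$ of oriented great circles contained in $U$ such that each point of $U$ lies on exactly one member of $\mathcal{F}$ and such that $\mathcal{F}$ is smoothly locally trivial: each point of $U$ lies in an open set $V \subseteq U$ for which there are an open set $D \subseteq \mathbb{R}^{2n}$ and a $C^\infty$ diffeomorphism $\Phi : D \times S^1 \to V$ that carries each $\{d\} \times S^1$, $d \in D$, onto a member of $\mathcal{F}$, preserving orientations. **Theorem B.** Every germ of a smooth fibration of $S^{2n+1}$ by oriented great circles extends to such a fibration of all of $S^{2n+1}$. That is: let $P$ be an oriented great circle and let $\mathcal{F}$ be a smooth fibration by oriented great circles of an open set $U \subseteq S^{2n+1}$ such that $P$ is one of the fibres of $\mathcal{F}$. Then there is a smooth fibration $\mathcal{G}$ of all of $S^{2n+1}$ by oriented great circles, having $P$ as a fibre, which agrees with $\mathcal{F}$ on a neighborhood of $P$: there is an open set $W$ with $P \subseteq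 W \subseteq U$ such that, for each $x \in W$, the oriented fibres of $\mathcal{F}$ and $\mathcal{G}$ through $x$ are the same. -/

import Mathlib

open scoped Manifold ContDiff

noncomputable section

/-- The Euclidean space `ℝ^{2n+2}`. -/
abbrev Ambient (n : ℕ) : Type := EuclideanSpace ℝ (Fin (2 * n + 1 + 1))

/-- The unit sphere `S^{2n+1}` in `ℝ^{2n+2}`, with Mathlib's smooth structure. -/
abbrev OddSphere (n : ℕ) : Type := Metric.sphere (0 : Ambient n) 1

/-- An oriented great circle of `S^{2n+1}`, given by the oriented 2-plane through the origin of
`ℝ^{2n+2}` that it spans. -/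
structure OrientedGreatCircle (n : ℕ) where
  /-- The 2-plane spanned by the circle. -/
  plane : Submodule ℝ (Ambient n)
  /-- The plane is two-dimensional. -/
  finrank_plane : Module.finrank ℝ plane = 2
  /-- The orientation of the plane. -/
  orientation : Orientation ℝ plane (Fin 2)

namespace OrientedGreatCircle

variable {n : ℕ}

instance fact_finrank_plane (C : OrientedGreatCircle n) :
    Fact (Module.finrank ℝ C.plane = 2) :=
  ⟨C.finrank_plane⟩

/-- The points of the great circle. -/
def carrier (C : OrientedGreatCircle n) : Set (OddSphere n) :=
  {x | (x : Ambient n) ∈ C.plane}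

/-- The positively oriented unit tangent vector of the oriented great circle `C` at the point
`x ∈ C`: the image of `x` under the rotation by `+90°` of the oriented plane of `C`.
(Outside the plane of `C` the value is irrelevant; there `x` is first projected to the plane.) -/
def unitTangent (C : OrientedGreatCircle n) (x : Ambient n) : Ambient n :=
  (C.orientation.rightAngleRotation (C.plane.orthogonalProjectionOnto x) : C.plane)

end OrientedGreatCircle

/-- A smooth local trivialization of a family `𝓕` of oriented great circles: a diffeomorphism `Φ`
from `D × S¹`, with `D` open in `ℝ^{2n}`, onto an open subset of `S^{2n+1}`, which maps each
`{d} × S¹` onto a great circle in `𝓕`, preserving orientations. -/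
structure IsSmoothLocalTrivialization {n : ℕ} (𝓕 : Set (OrientedGreatCircle n))
    (D : Set (EuclideanSpace ℝ (Fin (2 * n))))
    (Φ : OpenPartialHomeomorph (EuclideanSpace ℝ (Fin (2 * n)) × Circle) (OddSphere n)) :
    Prop where
  isOpen_base : IsOpen D
  source_eq : Φ.source = D ×ˢ Set.univ
  contMDiffOn : ContMDiffOn ((𝓡 (2 * n)).prod (𝓡 1)) (𝓡 (2 * n + 1)) ∞ Φ Φ.source
  contMDiffOn_symm :
    ContMDiffOn (𝓡 (2 * n + 1)) ((𝓡 (2 * n)).prod (𝓡 1)) ∞ Φ.symm Φ.target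
  fibre : ∀ d ∈ D, ∃ C ∈ 𝓕,
    Set.range (fun z : Circle => Φ (d, z)) = C.carrier ∧
    ∀ t : ℝ, ∃ c : ℝ, 0 < c ∧
      HasDerivAt (fun s : ℝ => (Φ (d, Circle.exp s) : Ambient n))
        (c • C.unitTangent (Φ (d, Circle.exp t))) t

/-- `𝓕` is (the set of fibres of) a smooth fibration by oriented great circles of the open subset
`U` of `S^{2n+1}`: the circles in `𝓕` partition `U`, and they form a smooth locally trivial
bundle of oriented circles. -/
structure IsSmoothGreatCircleFibration {n : ℕ} (𝓕 : Set (OrientedGreatCircle n))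
    (U : Set (OddSphere n)) : Prop where
  isOpen : IsOpen U
  carrier_subset : ∀ C ∈ 𝓕, C.carrier ⊆ U
  existsUnique_fibre : ∀ x ∈ U, ∃! C : OrientedGreatCircle n, C ∈ 𝓕 ∧ x ∈ C.carrier
  locally_trivial : ∀ x ∈ U, ∃ D Φ, IsSmoothLocalTrivialization 𝓕 D Φ ∧ x ∈ Φ.target

/-- The fibrations `𝓕₁` of `U₁` and `𝓕₂` of `U₂` agree on some neighborhood `W` of `P` contained
in both domains: through each point of `W` they have the same oriented fibre. This is the relation
of defining the same germ along `P`. -/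
def AgreeNear {n : ℕ} (P : OrientedGreatCircle n) (𝓕₁ : Set (OrientedGreatCircle n))
    (U₁ : Set (OddSphere n)) (𝓕₂ : Set (OrientedGreatCircle n)) (U₂ : Set (OddSphere n)) : Prop :=
  ∃ W : Set (OddSphere n), IsOpen W ∧ P.carrier ⊆ W ∧ W ⊆ U₁ ∧ W ⊆ U₂ ∧
    ∀ x ∈ W, ∀ C : OrientedGreatCircle n, x ∈ C.carrier → (C ∈ 𝓕₁ ↔ C ∈ 𝓕₂)

end

/-!
# Germs of great circle fibrations of odd spheres extend to the whole sphere

Let `P` have the oriented orthonormal basis `e₁, e₂`, and identify the orthogonal complement of its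
plane with `V = ℝ^{2n}` (`PlaneFrame`). The fibres near `P` are the planes
`span (e₁ + y, e₂ + f y)` for the germ at `0` of a smooth map `f : V → V` with `f 0 = 0`
(`IsSmoothGreatCircleFibration.exists_graph_germ`). For distinct `y, y'` two such planes meet only
in `0` iff `a (y - y') + b (f y - f y') ≠ 0` for all `(a, b) ≠ 0`. Infinitesimally this says that
the derivative `T` of `f` at `0` has no real eigenvalue, which holds because the fibration is
smoothly trivial near `P`.

The extension is made on the level of `f` (`exists_isUniformlyTransverse`). Close to the origin `f`
is cut off to the linear map `T`. Then `T` is joined by a segment to a linear complex structure `J`,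
equal to `i` on the generalized eigenspaces of `T` for eigenvalues in the upper half plane and to
`-i` on the others; no map on the segment has a real eigenvalue (`exists_complexStructure`). The
map `T` is deformed into `J` along this segment as the radius `|y|` grows. When this is done slowly
on a logarithmic scale, `f y - f y'` differs from `S (y - y')`, with `S` on the segment, by at most
a small multiple of `|y - y'|`. Since the segment is compact, the planes remain transverse,
uniformly. This global estimate is `IsUniformlyTransverse`.

Through each point `x = a (e₁ + y) + b (e₂ + f y)` with `(a, b) ≠ 0` there is now exactly one
plane: the map `y ↦ a y + b f y` expands distances and is a local diffeomorphism, so its image is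
open and closed. Near `V` itself `f = J`, so the planes fit together with the complex lines of `J`
in `V`. To see that this is smooth, one encodes a fibration by the field `X` with
`X x = a (e₂ + f y) - b (e₁ + y)`, which spans the fibre through `x` together with `x` and satisfies
`X (α x + β X x) = α X x - β x` (`IsQuarterTurnField`). For any such smooth field there are explicit
local trivializations: the fibre through a point is followed to its intersection with an affine
slice (`PlaneFrame.triv`).
-/

noncomputable section

/-! ### Oriented great circles and positively oriented bases -/

section OrientedPlane

variable {V : Type*} [NormedAddCommGroup V] [InnerProductSpace ℝ V]
  [Fact (Module.finrank ℝ V = 2)]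

/-- The expansion of a vector in the orthonormal basis `(u, J u)` of an oriented plane. -/
lemma Orientation.eq_inner_smul_add_areaForm_smul (o : Orientation ℝ V (Fin 2)) {u : V} (v : V)
    (h1 : ‖u‖ = 1) : v = inner ℝ u v • u + o.areaForm u v • o.rightAngleRotation u := by
  refine ext_inner_right ℝ fun w => ?_
  rw [inner_add_left, inner_smul_left, inner_smul_left, o.inner_rightAngleRotation_left]
  have := o.inner_mul_inner_add_areaForm_mul_areaForm u v w
  rw [h1] at this
  simp only [conj_trivial]
  linarith

lemma Orientation.areaForm_ne_zero (o : Orientation ℝ V (Fin 2)) {u v : V}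
    (h : LinearIndependent ℝ ![u, v]) : o.areaForm u v ≠ 0 := by
  intro h1
  have h2 := o.inner_mul_inner_add_areaForm_mul_areaForm' u v
  rw [h1, zero_smul, add_zero] at h2
  have h3 : (inner ℝ u v) • u = (‖u‖ ^ 2) • v := by
    refine ext_inner_right ℝ fun w => ?_
    rw [inner_smul_left, inner_smul_left]
    exact congrArg (fun l => l w) h2
  have h4 := (LinearIndependent.pair_iff.1 h) (inner ℝ u v) (-(‖u‖ ^ 2)) (by rw [h3]; simp)
  have : ‖u‖ ^ 2 = 0 := by linarith [h4.2]
  simp only [ne_eq, OfNat.ofNat_ne_zero, not_false_eq_true, pow_eq_zero_iff, norm_eq_zero] at this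
  exact h.ne_zero 0 this

end OrientedPlane

lemma finrank_span_pair {V : Type*} [AddCommGroup V] [Module ℝ V] {u v : V}
    (h : LinearIndependent ℝ ![u, v]) :
    Module.finrank ℝ (Submodule.span ℝ ({u, v} : Set V)) = 2 := by
  have := finrank_span_eq_card h
  rwa [Matrix.range_cons_cons_empty, Fintype.card_fin] at this

namespace OrientedGreatCircle

variable {n : ℕ}

/-- `C.IsPos u v`: the pair `(u, v)` is a positively oriented basis of the oriented plane of `C`. -/
def IsPos (C : OrientedGreatCircle n) (u v : Ambient n) : Prop :=
  u ∈ C.plane ∧ v ∈ C.plane ∧ 0 < inner ℝ (C.unitTangent u) v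

/-- The area form of the oriented plane of `C`, pulled back to the ambient space by the
orthogonal projection. -/
def area (C : OrientedGreatCircle n) (u v : Ambient n) : ℝ :=
  C.orientation.areaForm (C.plane.orthogonalProjectionOnto u) (C.plane.orthogonalProjectionOnto v)

lemma inner_unitTangent (C : OrientedGreatCircle n) (u v : Ambient n) :
    inner ℝ (C.unitTangent u) v = C.area u v := by
  unfold unitTangent area
  rw [← Orientation.inner_rightAngleRotation_left]
  exact (Submodule.inner_orthogonalProjectionOnto_eq_of_mem_left _ _).symm

lemma area_comb (C : OrientedGreatCircle n) (u v : Ambient n) (a b c d : ℝ) :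
    C.area (a • u + b • v) (c • u + d • v) = (a * d - b * c) * C.area u v := by
  unfold area
  simp only [map_add, map_smul, LinearMap.add_apply, LinearMap.smul_apply, smul_eq_mul,
    Orientation.areaForm_apply_self]
  rw [C.orientation.areaForm_swap (C.plane.orthogonalProjectionOnto v)]
  ring

lemma area_self (C : OrientedGreatCircle n) (u : Ambient n) : C.area u u = 0 := by
  simp [area]

lemma unitTangent_mem (C : OrientedGreatCircle n) (u : Ambient n) : C.unitTangent u ∈ C.plane :=
  Submodule.coe_mem _

lemma orthogonalProjectionOnto_of_mem (C : OrientedGreatCircle n) {u : Ambient n}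
    (hu : u ∈ C.plane) : C.plane.orthogonalProjectionOnto u = ⟨u, hu⟩ :=
  Submodule.orthogonalProjectionOnto_mem_subspace_eq_self (⟨u, hu⟩ : C.plane)

lemma norm_unitTangent (C : OrientedGreatCircle n) {u : Ambient n} (hu : u ∈ C.plane) :
    ‖C.unitTangent u‖ = ‖u‖ := by
  rw [unitTangent, orthogonalProjectionOnto_of_mem C hu, ← Submodule.coe_norm,
    LinearIsometryEquiv.norm_map]
  rfl

lemma inner_unitTangent_self (C : OrientedGreatCircle n) (u : Ambient n) :
    inner ℝ (C.unitTangent u) u = 0 := by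
  rw [inner_unitTangent, area_self]

lemma isPos_iff (C : OrientedGreatCircle n) (u v : Ambient n) :
    C.IsPos u v ↔ u ∈ C.plane ∧ v ∈ C.plane ∧ 0 < C.area u v := by
  rw [IsPos, inner_unitTangent]

lemma isPos_unitTangent (C : OrientedGreatCircle n) {u : Ambient n} (hu : u ∈ C.plane)
    (h0 : u ≠ 0) : C.IsPos u (C.unitTangent u) := by
  refine ⟨hu, C.unitTangent_mem u, ?_⟩
  rw [real_inner_self_eq_norm_sq, C.norm_unitTangent hu]
  positivity

/-- In an oriented plane the component of `v` along the rotated unit vector `u` is the area of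
`(u, v)`. -/
lemma eq_inner_smul_add (C : OrientedGreatCircle n) {u v : Ambient n} (hu : u ∈ C.plane)
    (hv : v ∈ C.plane) (h1 : ‖u‖ = 1) :
    v = inner ℝ u v • u + C.area u v • C.unitTangent u := by
  have key := C.orientation.eq_inner_smul_add_areaForm_smul (u := ⟨u, hu⟩) ⟨v, hv⟩ h1
  have := congrArg (Subtype.val) key
  simpa [area, unitTangent, orthogonalProjectionOnto_of_mem C hu,
    orthogonalProjectionOnto_of_mem C hv] using this

lemma IsPos.comb {C : OrientedGreatCircle n} {u v : Ambient n} (h : C.IsPos u v) {a b c d : ℝ}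
    (hd : 0 < a * d - b * c) : C.IsPos (a • u + b • v) (c • u + d • v) := by
  rw [isPos_iff] at h ⊢
  obtain ⟨hu, hv, hp⟩ := h
  refine ⟨C.plane.add_mem (C.plane.smul_mem _ hu) (C.plane.smul_mem _ hv),
    C.plane.add_mem (C.plane.smul_mem _ hu) (C.plane.smul_mem _ hv), ?_⟩
  rw [area_comb]
  positivity

lemma IsPos.linearIndependent {C : OrientedGreatCircle n} {u v : Ambient n} (h : C.IsPos u v) :
    LinearIndependent ℝ ![u, v] := by
  rw [isPos_iff] at h
  rw [LinearIndependent.pair_iff]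
  intro s t hst
  have h1 : C.area (s • u + t • v) ((0 : ℝ) • u + (1 : ℝ) • v) = 0 := by
    rw [hst]; simp [area]
  have h2 : C.area (s • u + t • v) ((1 : ℝ) • u + (0 : ℝ) • v) = 0 := by
    rw [hst]; simp [area]
  rw [area_comb] at h1 h2
  have := h.2.2.ne'
  simp [this] at h1 h2
  exact ⟨h1, h2⟩

lemma IsPos.plane_eq {C : OrientedGreatCircle n} {u v : Ambient n} (h : C.IsPos u v) :
    C.plane = Submodule.span ℝ {u, v} := by
  symm
  apply Submodule.eq_of_le_of_finrank_eq
  · rw [Submodule.span_le]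
    rintro x (rfl | rfl)
    exacts [h.1, h.2.1]
  · rw [C.finrank_plane, finrank_span_pair h.linearIndependent]

lemma IsPos.exists_comb {C : OrientedGreatCircle n} {u v x : Ambient n} (h : C.IsPos u v)
    (hx : x ∈ C.plane) : ∃ a b : ℝ, x = a • u + b • v := by
  rw [h.plane_eq, Submodule.mem_span_pair] at hx
  obtain ⟨a, b, h⟩ := hx
  exact ⟨a, b, h.symm⟩

/-- An oriented great circle is determined by a positively oriented basis of its plane. -/
lemma IsPos.unique {C C' : OrientedGreatCircle n} {u v : Ambient n} (h : C.IsPos u v)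
    (h' : C'.IsPos u v) : C = C' := by
  have hp : C.plane = C'.plane := h.plane_eq.trans h'.plane_eq.symm
  obtain ⟨p, hf, o⟩ := C
  obtain ⟨p', hf', o'⟩ := C'
  simp only at hp
  subst hp
  congr 1
  rcases o.eq_or_eq_neg o' (by simp [hf]) with h1 | h1
  · exact h1
  · exfalso
    have h2 := h.2.2
    have h3 := h'.2.2
    rw [inner_unitTangent] at h2 h3
    have : Fact (Module.finrank ℝ p = 2) := ⟨hf⟩
    unfold area at h2 h3
    simp only at h2 h3
    rw [h1, Orientation.areaForm_neg_orientation] at h2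
    simp only [LinearMap.neg_apply] at h2
    linarith

lemma exists_isPos {u v : Ambient n} (h : LinearIndependent ℝ ![u, v]) :
    ∃ C : OrientedGreatCircle n, C.IsPos u v := by
  have hf := finrank_span_pair h
  have hu : u ∈ Submodule.span ℝ {u, v} := Submodule.subset_span (by simp)
  have hv : v ∈ Submodule.span ℝ {u, v} := Submodule.subset_span (by simp)
  have : Fact (Module.finrank ℝ (Submodule.span ℝ {u, v}) = 2) := ⟨hf⟩
  let o : Orientation ℝ (Submodule.span ℝ {u, v}) (Fin 2) :=
    ((Module.finBasisOfFinrankEq ℝ _ hf)).orientation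
  have key : ∀ o : Orientation ℝ (Submodule.span ℝ {u, v}) (Fin 2),
      0 < o.areaForm ⟨u, hu⟩ ⟨v, hv⟩ → ∃ C : OrientedGreatCircle n, C.IsPos u v := by
    intro o ho
    refine ⟨⟨_, hf, o⟩, hu, hv, ?_⟩
    rw [inner_unitTangent, area, orthogonalProjectionOnto_of_mem _ hu,
      orthogonalProjectionOnto_of_mem _ hv]
    exact ho
  rcases lt_trichotomy (o.areaForm ⟨u, hu⟩ ⟨v, hv⟩) 0 with h1 | h1 | h1
  · apply key (-o)
    rw [Orientation.areaForm_neg_orientation]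
    simpa using h1
  · refine absurd h1 (o.areaForm_ne_zero ?_)
    refine LinearIndependent.of_comp (Submodule.span ℝ {u, v}).subtype ?_
    convert h using 1
    ext i
    fin_cases i <;> rfl
  · exact key o h1

end OrientedGreatCircle

/-! ### Frames adapted to a plane, and smooth maps into the sphere -/

/-- An orthogonal splitting `ℝ^{2n+2} = ℝ e₁ ⊕ ℝ e₂ ⊕ ι(ℝ^{2n})`, where `e₁, e₂` are orthonormal
and `ι` is an isometric embedding; `π` is the orthogonal projection onto the last summand. -/
structure PlaneFrame (n : ℕ) where
  /-- The first vector of the frame. -/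
  e₁ : Ambient n
  /-- The second vector of the frame. -/
  e₂ : Ambient n
  /-- The isometric embedding onto the orthogonal complement. -/
  ι : EuclideanSpace ℝ (Fin (2 * n)) →L[ℝ] Ambient n
  /-- The orthogonal projection onto the complement. -/
  π : Ambient n →L[ℝ] EuclideanSpace ℝ (Fin (2 * n))
  inner_e₁_e₁ : inner ℝ e₁ e₁ = (1 : ℝ)
  inner_e₂_e₂ : inner ℝ e₂ e₂ = (1 : ℝ)
  inner_e₁_e₂ : inner ℝ e₁ e₂ = (0 : ℝ)
  inner_e₁_ι : ∀ y, inner ℝ e₁ (ι y) = (0 : ℝ)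
  inner_e₂_ι : ∀ y, inner ℝ e₂ (ι y) = (0 : ℝ)
  π_ι : ∀ y, π (ι y) = y
  decomp : ∀ v, v = (inner ℝ e₁ v : ℝ) • e₁ + (inner ℝ e₂ v : ℝ) • e₂ + ι (π v)

namespace PlaneFrame

variable {n : ℕ} (φ : PlaneFrame n)

/-- The coordinate along `e₁`. -/
def a (v : Ambient n) : ℝ := inner ℝ φ.e₁ v

/-- The coordinate along `e₂`. -/
def b (v : Ambient n) : ℝ := inner ℝ φ.e₂ v

lemma eq_coords (v : Ambient n) : v = φ.a v • φ.e₁ + φ.b v • φ.e₂ + φ.ι (φ.π v) := φ.decomp v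

lemma ι_injective : Function.Injective φ.ι := fun x y h => by
  rw [← φ.π_ι x, h, φ.π_ι]

@[simp] lemma a_e₁ : φ.a φ.e₁ = 1 := φ.inner_e₁_e₁
@[simp] lemma a_e₂ : φ.a φ.e₂ = 0 := φ.inner_e₁_e₂
@[simp] lemma b_e₁ : φ.b φ.e₁ = 0 := (real_inner_comm _ _).trans φ.inner_e₁_e₂
@[simp] lemma b_e₂ : φ.b φ.e₂ = 1 := φ.inner_e₂_e₂
@[simp] lemma a_ι (y) : φ.a (φ.ι y) = 0 := φ.inner_e₁_ι y
@[simp] lemma b_ι (y) : φ.b (φ.ι y) = 0 := φ.inner_e₂_ι y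
@[simp] lemma pi_ι (y) : φ.π (φ.ι y) = y := φ.π_ι y
@[simp] lemma a_zero : φ.a 0 = 0 := inner_zero_right _
@[simp] lemma b_zero : φ.b 0 = 0 := inner_zero_right _
@[simp] lemma a_add (u v) : φ.a (u + v) = φ.a u + φ.a v := inner_add_right _ _ _
@[simp] lemma b_add (u v) : φ.b (u + v) = φ.b u + φ.b v := inner_add_right _ _ _
@[simp] lemma a_sub (u v) : φ.a (u - v) = φ.a u - φ.a v := inner_sub_right _ _ _
@[simp] lemma b_sub (u v) : φ.b (u - v) = φ.b u - φ.b v := inner_sub_right _ _ _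
@[simp] lemma a_smul (c : ℝ) (v) : φ.a (c • v) = c * φ.a v := inner_smul_right _ _ _
@[simp] lemma b_smul (c : ℝ) (v) : φ.b (c • v) = c * φ.b v := inner_smul_right _ _ _

@[simp] lemma pi_e₁ : φ.π φ.e₁ = 0 := by
  apply φ.ι_injective
  have := φ.eq_coords φ.e₁
  simp only [a_e₁, one_smul, b_e₁, zero_smul, add_zero, left_eq_add] at this
  rw [this, map_zero]

@[simp] lemma pi_e₂ : φ.π φ.e₂ = 0 := by
  apply φ.ι_injective
  have := φ.eq_coords φ.e₂
  simp only [a_e₂, one_smul, b_e₂, zero_smul, zero_add, left_eq_add] at this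
  rw [this, map_zero]

lemma ext_coords {u v : Ambient n} (ha : φ.a u = φ.a v) (hb : φ.b u = φ.b v)
    (hπ : φ.π u = φ.π v) : u = v := by
  rw [φ.eq_coords u, φ.eq_coords v, ha, hb, hπ]

lemma contDiff_a : ContDiff ℝ ∞ φ.a := contDiff_const.inner ℝ contDiff_id

lemma contDiff_b : ContDiff ℝ ∞ φ.b := contDiff_const.inner ℝ contDiff_id

end PlaneFrame

/-- Every unit vector `u` in the plane of an oriented great circle `C` is the first vector of a
frame whose second vector is the unit tangent of `C` at `u`. -/
lemma OrientedGreatCircle.exists_frame {n : ℕ} (C : OrientedGreatCircle n) {u : Ambient n}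
    (hu : u ∈ C.plane) (h1 : ‖u‖ = 1) :
    ∃ φ : PlaneFrame n, φ.e₁ = u ∧ φ.e₂ = C.unitTangent u := by
  have hd : Module.finrank ℝ C.planeᗮ = 2 * n := by
    have := C.plane.finrank_add_finrank_orthogonal
    rw [C.finrank_plane, finrank_euclideanSpace_fin] at this
    omega
  let b := (stdOrthonormalBasis ℝ C.planeᗮ).reindex (finCongr hd)
  have horth : ∀ v ∈ C.plane, ∀ w : C.planeᗮ, inner ℝ v (w : Ambient n) = 0 := fun v hv w =>
    Submodule.inner_right_of_mem_orthogonal hv w.2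
  refine ⟨⟨u, C.unitTangent u, C.planeᗮ.subtypeL ∘L b.repr.symm.toContinuousLinearEquiv,
    b.repr.toContinuousLinearEquiv ∘L C.planeᗮ.orthogonalProjectionOnto, ?_, ?_, ?_, ?_, ?_, ?_, ?_⟩,
    rfl, rfl⟩
  · rw [real_inner_self_eq_norm_sq, h1, one_pow]
  · rw [real_inner_self_eq_norm_sq, C.norm_unitTangent hu, h1, one_pow]
  · rw [real_inner_comm, C.inner_unitTangent_self]
  · exact fun y => horth _ hu _
  · exact fun y => horth _ (C.unitTangent_mem u) _
  · intro y
    simp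
  · intro v
    have h2 := C.eq_inner_smul_add hu (C.plane.orthogonalProjectionOnto v).2 h1
    have h3 := C.plane.starProjection_add_starProjection_orthogonal v
    have h4 : inner ℝ u (C.plane.orthogonalProjectionOnto v : Ambient n) = (inner ℝ u v : ℝ) :=
      (Submodule.inner_orthogonalProjectionOnto_eq_of_mem_left ⟨u, hu⟩ v)
    have h5 : C.area u (C.plane.orthogonalProjectionOnto v : Ambient n)
        = inner ℝ (C.unitTangent u) v := by
      rw [C.inner_unitTangent, OrientedGreatCircle.area, OrientedGreatCircle.area]
      congr 1
      exact Submodule.orthogonalProjectionOnto_mem_subspace_eq_self _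
    rw [h4, h5] at h2
    rw [← h2]
    rw [Submodule.starProjection_apply, Submodule.starProjection_apply] at h3
    convert h3.symm using 2
    change ((b.repr.symm (b.repr _) : C.planeᗮ) : Ambient n) = _
    rw [b.repr.symm_apply_apply]
    rfl

section SphereMaps

variable {F : Type*} [NormedAddCommGroup F] [NormedSpace ℝ F] {H : Type*} [TopologicalSpace H]
  {I : ModelWithCorners ℝ F H} {M : Type*} [TopologicalSpace M] [ChartedSpace H M]

/-- A map into the sphere is smooth on a set if it is so as a map into the ambient space. -/
lemma contMDiffOn_sphere_of_coe {E : Type*} [NormedAddCommGroup E] [InnerProductSpace ℝ E]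
    {k : ℕ} [Fact (Module.finrank ℝ E = k + 1)] {m : ℕ∞ω} [IsManifold I m M]
    {g : M → Metric.sphere (0 : E) 1} {s : Set M}
    (hg : ContMDiffOn I 𝓘(ℝ, E) m (fun x => (g x : E)) s) : ContMDiffOn I (𝓡 k) m g s := by
  rw [contMDiffOn_iff_target]
  refine ⟨continuousOn_iff_continuous_domRestrict.2
    (continuous_induced_rng.2 (continuousOn_iff_continuous_domRestrict.1 hg.continuousOn)), ?_⟩
  intro v
  let U : _ ≃ₗᵢ[ℝ] _ :=
    (OrthonormalBasis.fromOrthogonalSpanSingleton (𝕜 := ℝ)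
        k (ne_zero_of_mem_unit_sphere (-v))).repr
  have h : ContDiffOn ℝ ω _ Set.univ := U.contDiff.contDiffOn
  have H₁ := (h.comp_inter contDiffOn_stereoToFun).contMDiffOn
  convert! (H₁.of_le le_top).comp' hg using 1
  ext x
  have hfxv : (g x : E) = -↑v ↔ inner ℝ (g x : E) (-↑v) = (1 : ℝ) := by
    have hfx : ‖(g x : E)‖ = 1 := by simp
    rw [inner_eq_one_iff_of_norm_eq_one hfx]
    exact norm_eq_of_mem_sphere (-v)
  simp [chartAt, ChartedSpace.chartAt, Subtype.ext_iff, hfxv, real_inner_comm]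

end SphereMaps

/-! ### Fibrations from quarter turn fields -/

/-- Radial projection of `ℝ^{2n+2}` to the unit sphere, with an arbitrary value at the origin. -/
def toSphere (n : ℕ) (v : Ambient n) : OddSphere n :=
  open Classical in
  if h : v ≠ 0 then ⟨‖v‖⁻¹ • v, by simp [norm_smul, h]⟩ else ⟨EuclideanSpace.single 0 1, by simp⟩

lemma coe_toSphere {n : ℕ} {v : Ambient n} (h : v ≠ 0) :
    (toSphere n v : Ambient n) = ‖v‖⁻¹ • v := by
  simp [toSphere, h]

lemma contDiffAt_normalize {V : Type*} [NormedAddCommGroup V] [InnerProductSpace ℝ V] {v : V}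
    (h : v ≠ 0) : ContDiffAt ℝ ∞ (fun v : V => ‖v‖⁻¹ • v) v :=
  ((contDiffAt_norm ℝ h).inv (norm_ne_zero_iff.2 h)).smul contDiffAt_id

lemma contMDiffOn_toSphere (n : ℕ) :
    ContMDiffOn 𝓘(ℝ, Ambient n) (𝓡 (2 * n + 1)) ∞ (toSphere n) {0}ᶜ := by
  have := Fact.mk (@finrank_euclideanSpace_fin ℝ _ (2 * n + 1 + 1))
  refine contMDiffOn_sphere_of_coe ?_
  rw [contMDiffOn_iff_contDiffOn]
  refine ContDiffOn.congr (f := fun v => ‖v‖⁻¹ • v) (fun v hv => ?_) fun v hv => coe_toSphere hv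
  exact (contDiffAt_normalize hv).contDiffWithinAt

/-- Radial projection of `ℂ` to the unit circle, with an arbitrary value at the origin. -/
def toCircle (w : ℂ) : Circle := Circle.exp w.arg

lemma coe_toCircle {w : ℂ} (h : w ≠ 0) : (toCircle w : ℂ) = (‖w‖⁻¹ : ℝ) • w := by
  have : (‖w‖ : ℂ) ≠ 0 := by simpa using h
  rw [toCircle, Circle.coe_exp, Complex.real_smul, Complex.ofReal_inv, eq_inv_mul_iff_mul_eq₀ this]
  exact Complex.norm_mul_exp_arg_mul_I w

lemma contMDiffOn_toCircle : ContMDiffOn 𝓘(ℝ, ℂ) (𝓡 1) ∞ toCircle {0}ᶜ := by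
  have := finrank_real_complex_fact'
  refine contMDiffOn_sphere_of_coe (E := ℂ) (g := toCircle) ?_
  rw [contMDiffOn_iff_contDiffOn]
  refine ContDiffOn.congr (f := fun v => (‖v‖⁻¹ : ℝ) • v) (fun v hv => ?_) fun v hv => coe_toCircle hv
  exact (contDiffAt_normalize hv).contDiffWithinAt

lemma contMDiff_coe_circle : ContMDiff (𝓡 1) 𝓘(ℝ, ℂ) ∞ (fun z : Circle => (z : ℂ)) := by
  have := finrank_real_complex_fact'
  exact contMDiff_coe_sphere (E := ℂ)

lemma contMDiff_coe_oddSphere (n : ℕ) :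
    ContMDiff (𝓡 (2 * n + 1)) 𝓘(ℝ, Ambient n) ∞ (fun x : OddSphere n => (x : Ambient n)) := by
  have := Fact.mk (@finrank_euclideanSpace_fin ℝ _ (2 * n + 1 + 1))
  exact contMDiff_coe_sphere

/-- A quarter turn field: a map `X`, smooth away from the origin, such that for `x ≠ 0` the vectors
`x` and `X x` span a plane on which `X` acts as the complex structure `x ↦ X x ↦ -x`. The planes,
oriented by `(x, X x)`, partition the complement of the origin. -/
structure IsQuarterTurnField {n : ℕ} (X : Ambient n → Ambient n) : Prop where
  contDiffAt : ∀ x ≠ 0, ContDiffAt ℝ ∞ X x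
  apply_comb : ∀ (x : Ambient n) (α β : ℝ), X (α • x + β • X x) = α • X x - β • x

/-- The oriented great circles tangent to the field `X`. -/
def fibresOf {n : ℕ} (X : Ambient n → Ambient n) : Set (OrientedGreatCircle n) :=
  {C | ∃ x ≠ 0, C.IsPos x (X x)}

namespace IsQuarterTurnField

variable {n : ℕ} {X : Ambient n → Ambient n} (hX : IsQuarterTurnField X)
include hX

lemma map_zero : X 0 = 0 := by simpa using hX.apply_comb 0 0 0

lemma map_smul (c : ℝ) (x : Ambient n) : X (c • x) = c • X x := by
  simpa using hX.apply_comb x c 0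

lemma comb_eq_zero {x : Ambient n} (hx : x ≠ 0) {α β : ℝ} (h : α • x + β • X x = 0) :
    α = 0 ∧ β = 0 := by
  have h1 := hX.apply_comb x α β
  rw [h, hX.map_zero] at h1
  have h2 : (α * α + β * β) • x = 0 := by
    have : (α * α + β * β) • x = α • (α • x + β • X x) - β • (α • X x - β • x) := by module
    rw [this, h, ← h1]; simp
  have h3 := (smul_eq_zero.1 h2).resolve_right hx
  constructor <;> nlinarith

lemma linearIndependent {x : Ambient n} (hx : x ≠ 0) : LinearIndependent ℝ ![x, X x] := by
  rw [LinearIndependent.pair_iff]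
  exact fun s t h => hX.comb_eq_zero hx h

lemma isPos_comb {C : OrientedGreatCircle n} {x : Ambient n} (h : C.IsPos x (X x)) {α β : ℝ}
    (hαβ : 0 < α * α + β * β) : C.IsPos (α • x + β • X x) (X (α • x + β • X x)) := by
  rw [hX.apply_comb]
  have := h.comb (a := α) (b := β) (c := -β) (d := α) (by linarith)
  rwa [neg_smul, neg_add_eq_sub] at this

lemma isPos_of_mem {C : OrientedGreatCircle n} (hC : C ∈ fibresOf X) {x : Ambient n}
    (hx : x ∈ C.plane) (h0 : x ≠ 0) : C.IsPos x (X x) := by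
  obtain ⟨w, -, hw⟩ := hC
  obtain ⟨α, β, rfl⟩ := hw.exists_comb hx
  refine hX.isPos_comb hw ?_
  by_contra hcon
  have h1 : α = 0 := by nlinarith
  have h2 : β = 0 := by nlinarith
  simp [h1, h2] at h0

lemma existsUnique_fibre (x : OddSphere n) :
    ∃! C : OrientedGreatCircle n, C ∈ fibresOf X ∧ x ∈ C.carrier := by
  have hx := ne_zero_of_mem_unit_sphere x
  obtain ⟨C, hC⟩ := OrientedGreatCircle.exists_isPos (hX.linearIndependent hx)
  refine ⟨C, ⟨⟨x, hx, hC⟩, hC.1⟩, fun C' hC' => ?_⟩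
  exact (hX.isPos_of_mem hC'.1 hC'.2 hx).unique hC

end IsQuarterTurnField

namespace PlaneFrame

variable {n : ℕ} (φ : PlaneFrame n) (X : Ambient n → Ambient n)

/-- The affine slice `e₁ + ι(ℝ^{2n})` transverse to the plane of the frame. -/
def slice (d : EuclideanSpace ℝ (Fin (2 * n))) : Ambient n := φ.e₁ + φ.ι d

/-- The determinant of the projections of `x` and `X x` to the plane of the frame. -/
def det (x : Ambient n) : ℝ := φ.a x * φ.b (X x) - φ.b x * φ.a (X x)

/-- Before normalization: the point at angle `p.2` on the circle through the slice point over
`p.1`. -/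
def preTriv (p : EuclideanSpace ℝ (Fin (2 * n)) × Circle) : Ambient n :=
  (p.2 : ℂ).re • φ.slice p.1 + (p.2 : ℂ).im • X (φ.slice p.1)

/-- The base coordinate of a point: the plane spanned by `x` and `X x` meets the slice over this
vector, provided that `det X x ≠ 0`. -/
def base (x : Ambient n) : EuclideanSpace ℝ (Fin (2 * n)) :=
  (φ.det X x)⁻¹ • φ.π (φ.b (X x) • x - φ.b x • X x)

/-- The angular coordinate of a point, before normalization. -/
def preAngle (x : Ambient n) : ℂ := ⟨φ.b (X x), φ.b x⟩

variable {X} (hX : IsQuarterTurnField X)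

@[simp] lemma a_slice (d) : φ.a (φ.slice d) = 1 := by simp [slice]
@[simp] lemma b_slice (d) : φ.b (φ.slice d) = 0 := by simp [slice]
@[simp] lemma pi_slice (d) : φ.π (φ.slice d) = d := by simp [slice]

lemma slice_ne_zero (d) : φ.slice d ≠ 0 := fun h => by
  have := φ.a_slice d
  rw [h] at this
  simp [a] at this

lemma det_slice (d) : φ.det X (φ.slice d) = φ.b (X (φ.slice d)) := by simp [det]

lemma contDiff_slice : ContDiff ℝ ∞ φ.slice := contDiff_const.add φ.ι.contDiff

lemma circle_re_sq (ζ : Circle) : (ζ : ℂ).re * (ζ : ℂ).re + (ζ : ℂ).im * (ζ : ℂ).im = 1 := by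
  have := ζ.normSq_coe
  rwa [Complex.normSq_apply] at this

include hX

lemma det_comb (x : Ambient n) (α β : ℝ) :
    φ.det X (α • x + β • X x) = (α * α + β * β) * φ.det X x := by
  simp only [det, hX.apply_comb, a_add, b_add, a_sub, b_sub, a_smul, b_smul]
  ring

lemma preTriv_ne_zero (p) : φ.preTriv X p ≠ 0 := fun h => by
  have h1 := hX.comb_eq_zero (φ.slice_ne_zero p.1) h
  have := circle_re_sq p.2
  simp [h1.1, h1.2] at this

omit hX in
/-- The point where the plane spanned by `x` and `X x` meets the slice. -/
lemma slice_base {x : Ambient n} (h : φ.det X x ≠ 0) :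
    φ.slice (φ.base X x) =
      ((φ.det X x)⁻¹ * φ.b (X x)) • x + (-((φ.det X x)⁻¹ * φ.b x)) • X x := by
  apply φ.ext_coords
  · simp only [a_slice, a_add, a_smul]
    field_simp
    simp only [det]; ring
  · simp only [b_slice, b_add, b_smul]
    ring
  · simp only [pi_slice, base, map_add, _root_.map_smul, map_sub]
    module

lemma X_slice_base {x : Ambient n} (h : φ.det X x ≠ 0) :
    X (φ.slice (φ.base X x)) =
      ((φ.det X x)⁻¹ * φ.b (X x)) • X x + ((φ.det X x)⁻¹ * φ.b x) • x := by
  rw [φ.slice_base h, hX.apply_comb]; module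

lemma det_slice_base {x : Ambient n} (h : 0 < φ.det X x) :
    0 < φ.det X (φ.slice (φ.base X x)) := by
  rw [φ.slice_base h.ne', φ.det_comb hX]
  have h1 : 0 < φ.b (X x) * φ.b (X x) + φ.b x * φ.b x := by
    by_contra hcon
    have h1 : φ.b (X x) = 0 := by nlinarith
    have h2 : φ.b x = 0 := by nlinarith
    simp [det, h1, h2] at h
  have : ((φ.det X x)⁻¹ * φ.b (X x)) * ((φ.det X x)⁻¹ * φ.b (X x)) +
      (-((φ.det X x)⁻¹ * φ.b x)) * (-((φ.det X x)⁻¹ * φ.b x)) =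
      (φ.det X x)⁻¹ ^ 2 * (φ.b (X x) * φ.b (X x) + φ.b x * φ.b x) := by ring
  rw [this]
  positivity

omit hX in
lemma preAngle_ne_zero {x : Ambient n} (h : φ.det X x ≠ 0) : φ.preAngle X x ≠ 0 := fun h0 => by
  have h1 : φ.b (X x) = 0 := congrArg Complex.re h0
  have h2 : φ.b x = 0 := congrArg Complex.im h0
  simp [det, h1, h2] at h

lemma X_preTriv (p) : X (φ.preTriv X p) =
    (p.2 : ℂ).re • X (φ.slice p.1) - (p.2 : ℂ).im • φ.slice p.1 := hX.apply_comb _ _ _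

lemma det_preTriv (p) : φ.det X (φ.preTriv X p) = φ.b (X (φ.slice p.1)) := by
  rw [preTriv, φ.det_comb hX, circle_re_sq, one_mul, det_slice]

lemma det_toSphere {v : Ambient n} (hv : v ≠ 0) :
    φ.det X (toSphere n v) = ‖v‖⁻¹ * ‖v‖⁻¹ * φ.det X v := by
  have := φ.det_comb hX v ‖v‖⁻¹ 0
  simpa [coe_toSphere hv] using this

lemma base_smul {x : Ambient n} {c : ℝ} (hc : c ≠ 0) : φ.base X (c • x) = φ.base X x := by
  have := φ.det_comb hX x c 0
  simp only [zero_smul, add_zero, mul_zero] at this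
  simp only [base, this, hX.map_smul, b_smul, ← _root_.map_smul]
  have h : (φ.det X x)⁻¹ = (c * c * φ.det X x)⁻¹ * (c * c) := by
    rw [mul_inv]; field_simp
  rw [h]
  congr 1
  module

lemma base_preTriv {p : EuclideanSpace ℝ (Fin (2 * n)) × Circle}
    (h : φ.b (X (φ.slice p.1)) ≠ 0) : φ.base X (φ.preTriv X p) = p.1 := by
  have h1 : φ.b (X (φ.preTriv X p)) • φ.preTriv X p - φ.b (φ.preTriv X p) • X (φ.preTriv X p) =
      (φ.b (X (φ.slice p.1)) * ((p.2 : ℂ).re * (p.2 : ℂ).re + (p.2 : ℂ).im * (p.2 : ℂ).im)) •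
        φ.slice p.1 := by
    rw [φ.X_preTriv hX]
    simp only [preTriv, b_add, b_sub, b_smul, b_slice]
    module
  rw [base, φ.det_preTriv hX, h1, circle_re_sq, mul_one, _root_.map_smul, pi_slice, smul_smul,
    inv_mul_cancel₀ h, one_smul]

lemma preAngle_smul_preTriv (c : ℝ) (p) : φ.preAngle X (c • φ.preTriv X p) =
    (c * φ.b (X (φ.slice p.1))) • (p.2 : ℂ) := by
  rw [preAngle, hX.map_smul, φ.X_preTriv hX]
  apply Complex.ext <;> simp [preTriv] <;> ring

end PlaneFrame

lemma toCircle_smul {c : ℝ} (hc : 0 < c) (ζ : Circle) : toCircle (c • (ζ : ℂ)) = ζ := by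
  ext1
  rw [coe_toCircle (by simp [hc.ne']), norm_smul, Circle.norm_coe, mul_one, smul_smul,
    Real.norm_of_nonneg hc.le, inv_mul_cancel₀ hc.ne', one_smul]

lemma toSphere_smul {n : ℕ} {c : ℝ} (hc : 0 < c) (x : OddSphere n) :
    toSphere n (c • (x : Ambient n)) = x := by
  have hx := ne_zero_of_mem_unit_sphere x
  ext1
  rw [coe_toSphere (smul_ne_zero hc.ne' hx), norm_smul]
  simp [smul_smul, abs_of_pos hc, hc.ne']

namespace PlaneFrame

variable {n : ℕ} (φ : PlaneFrame n) {X : Ambient n → Ambient n} (hX : IsQuarterTurnField X)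
include hX

lemma toSphere_preTriv_base (x : OddSphere n) (h : 0 < φ.det X x) :
    toSphere n (φ.preTriv X (φ.base X x, toCircle (φ.preAngle X x))) = x := by
  have hne := φ.preAngle_ne_zero h.ne'
  have hpos : 0 < ‖φ.preAngle X x‖ := norm_pos_iff.2 hne
  have hsq : ‖φ.preAngle X x‖ * ‖φ.preAngle X x‖ =
      φ.b (X x) * φ.b (X x) + φ.b x * φ.b x := by
    rw [Complex.norm_mul_self_eq_normSq, Complex.normSq_apply]; rfl
  have key : φ.preTriv X (φ.base X x, toCircle (φ.preAngle X x)) =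
      (‖φ.preAngle X x‖ * (φ.det X x)⁻¹) • (x : Ambient n) := by
    simp only [preTriv, coe_toCircle hne]
    have h1 : ((‖φ.preAngle X x‖⁻¹ : ℝ) • φ.preAngle X x).re =
      ‖φ.preAngle X x‖⁻¹ * φ.b (X x) := by simp [preAngle]
    have h2 : ((‖φ.preAngle X x‖⁻¹ : ℝ) • φ.preAngle X x).im =
      ‖φ.preAngle X x‖⁻¹ * φ.b x := by simp [preAngle]
    rw [h1, h2, φ.X_slice_base hX h.ne', φ.slice_base h.ne']
    have h3 : ‖φ.preAngle X x‖ = ‖φ.preAngle X x‖⁻¹ *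
        (φ.b (X x) * φ.b (X x) + φ.b x * φ.b x) := by
      rw [← hsq]; field_simp
    conv_rhs => rw [h3]
    module
  rw [key]
  exact toSphere_smul (by positivity) x

lemma contMDiff_toSphere_preTriv : ContMDiff ((𝓡 (2 * n)).prod (𝓡 1)) (𝓡 (2 * n + 1)) ∞
    (fun p => toSphere n (φ.preTriv X p)) := by
  have h1 : ContMDiff ((𝓡 (2 * n)).prod (𝓡 1)) 𝓘(ℝ, ℂ) ∞
      (fun p : EuclideanSpace ℝ (Fin (2 * n)) × Circle => (p.2 : ℂ)) :=
    contMDiff_coe_circle.comp contMDiff_snd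
  have h2 : ContDiff ℝ ∞ fun d => X (φ.slice d) := contDiff_iff_contDiffAt.2 fun d =>
    (hX.contDiffAt _ (φ.slice_ne_zero d)).comp d φ.contDiff_slice.contDiffAt
  have h3 : ContMDiff ((𝓡 (2 * n)).prod (𝓡 1)) 𝓘(ℝ, Ambient n) ∞ (φ.preTriv X) :=
    ((Complex.reCLM.contMDiff.comp h1).smul (φ.contDiff_slice.contMDiff.comp contMDiff_fst)).add
      ((Complex.imCLM.contMDiff.comp h1).smul (h2.contMDiff.comp contMDiff_fst))
  exact (contMDiffOn_toSphere n).comp_contMDiff h3 fun p => φ.preTriv_ne_zero hX p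

lemma contDiffAt_a_X {x : Ambient n} (h : x ≠ 0) : ContDiffAt ℝ ∞ (fun x => φ.a (X x)) x :=
  φ.contDiff_a.contDiffAt.comp x (hX.contDiffAt x h)

lemma contDiffAt_b_X {x : Ambient n} (h : x ≠ 0) : ContDiffAt ℝ ∞ (fun x => φ.b (X x)) x :=
  φ.contDiff_b.contDiffAt.comp x (hX.contDiffAt x h)

lemma contDiffAt_det {x : Ambient n} (h : x ≠ 0) : ContDiffAt ℝ ∞ (φ.det X) x :=
  (φ.contDiff_a.contDiffAt.mul (φ.contDiffAt_b_X hX h)).sub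
    (φ.contDiff_b.contDiffAt.mul (φ.contDiffAt_a_X hX h))

omit hX in
lemma ne_zero_of_det {x : Ambient n} (h : φ.det X x ≠ 0) : x ≠ 0 := fun h0 => by
  simp [det, h0, a, b] at h

lemma isOpen_base_triv : IsOpen {d | 0 < φ.b (X (φ.slice d))} :=
  isOpen_lt continuous_const (continuous_iff_continuousAt.2 fun d =>
    ContinuousAt.comp (g := fun x => φ.b (X x))
      (φ.contDiffAt_b_X hX (φ.slice_ne_zero d)).continuousAt
      φ.contDiff_slice.continuous.continuousAt)

lemma contMDiffOn_inverse_triv : ContMDiffOn (𝓡 (2 * n + 1)) ((𝓡 (2 * n)).prod (𝓡 1)) ∞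
    (fun x : OddSphere n => (φ.base X x, toCircle (φ.preAngle X x))) {x | 0 < φ.det X x} := by
  have hs : ∀ x ∈ {x : Ambient n | 0 < φ.det X x}, x ≠ 0 :=
    fun x hx => φ.ne_zero_of_det (ne_of_gt hx)
  have h1 : ContDiffOn ℝ ∞ (φ.base X) {x | 0 < φ.det X x} := fun x hx =>
    (((φ.contDiffAt_det hX (hs x hx)).inv (ne_of_gt hx)).smul (φ.π.contDiff.contDiffAt.comp x
      (((φ.contDiffAt_b_X hX (hs x hx)).smul contDiffAt_id).sub
        (φ.contDiff_b.contDiffAt.smul (hX.contDiffAt x (hs x hx)))))).contDiffWithinAt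
  have h2 : ContDiffOn ℝ ∞ (φ.preAngle X) {x | 0 < φ.det X x} := fun x hx => by
    have : φ.preAngle X = fun x => (φ.b (X x)) • (1 : ℂ) + (φ.b x) • Complex.I := by
      funext x
      apply Complex.ext <;> simp [preAngle]
    rw [this]
    exact (((φ.contDiffAt_b_X hX (hs x hx)).smul contDiffAt_const).add
      (φ.contDiff_b.contDiffAt.smul contDiffAt_const)).contDiffWithinAt
  have h3 := (contMDiff_coe_oddSphere n).contMDiffOn (s := {x : OddSphere n | 0 < φ.det X x})
  refine (h1.contMDiffOn.comp h3 fun x hx => hx).prodMk ?_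
  exact contMDiffOn_toCircle.comp (h2.contMDiffOn.comp h3 fun x hx => hx)
    fun x hx => φ.preAngle_ne_zero (ne_of_gt hx)

/-- The local trivialization, determined by a frame, of the circles tangent to `X`. -/
def triv : OpenPartialHomeomorph (EuclideanSpace ℝ (Fin (2 * n)) × Circle) (OddSphere n) where
  toFun p := toSphere n (φ.preTriv X p)
  invFun x := (φ.base X x, toCircle (φ.preAngle X x))
  source := {d | 0 < φ.b (X (φ.slice d))} ×ˢ Set.univ
  target := {x | 0 < φ.det X x}
  map_source' := by
    rintro p ⟨hp, -⟩
    have h := φ.preTriv_ne_zero hX p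
    have h1 : 0 < ‖φ.preTriv X p‖⁻¹ := inv_pos.2 (norm_pos_iff.2 h)
    simp only [Set.mem_ofPred_eq] at hp ⊢
    rw [φ.det_toSphere hX h, φ.det_preTriv hX]
    positivity
  map_target' := by
    intro x hx
    refine ⟨?_, trivial⟩
    have := φ.det_slice_base hX hx
    rwa [det_slice] at this
  left_inv' := by
    rintro p ⟨hp, -⟩
    have hp : 0 < φ.b (X (φ.slice p.1)) := hp
    have h := φ.preTriv_ne_zero hX p
    have h1 : 0 < ‖φ.preTriv X p‖⁻¹ := inv_pos.2 (norm_pos_iff.2 h)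
    rw [coe_toSphere h, φ.base_smul hX h1.ne', φ.base_preTriv hX hp.ne',
      φ.preAngle_smul_preTriv hX, toCircle_smul (mul_pos h1 hp)]
  right_inv' := fun x hx => φ.toSphere_preTriv_base hX x hx
  open_source := (φ.isOpen_base_triv hX).prod isOpen_univ
  open_target := by
    refine isOpen_lt continuous_const ?_
    exact continuous_iff_continuousAt.2 fun x => ContinuousAt.comp
      (φ.contDiffAt_det hX (ne_zero_of_mem_unit_sphere x)).continuousAt
      continuous_subtype_val.continuousAt
  continuousOn_toFun := (φ.contMDiff_toSphere_preTriv hX).continuous.continuousOn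
  continuousOn_invFun := (φ.contMDiffOn_inverse_triv hX).continuousOn

omit hX in
lemma inner_deriv_unit_curve {γ : ℝ → Ambient n} {v : Ambient n} {t : ℝ}
    (h1 : ∀ s, ‖γ s‖ = 1) (h : HasDerivAt γ v t) : inner ℝ (γ t) v = (0 : ℝ) := by
  have h2 := h.inner ℝ h
  have h3 : (fun s => (inner ℝ (γ s) (γ s) : ℝ)) = fun _ => 1 := by
    funext s
    rw [real_inner_self_eq_norm_sq, h1, one_pow]
  rw [h3] at h2
  have := h2.unique (hasDerivAt_const t (1 : ℝ))
  rw [real_inner_comm (γ t) v] at this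
  linarith

/-- Along a circle tangent to `X` the trivialization moves in the positive direction. -/
lemma hasDerivAt_triv {C : OrientedGreatCircle n} {w : Ambient n} (hC : C.IsPos w (X w))
    (hw : w ≠ 0) (t : ℝ) : ∃ c : ℝ, 0 < c ∧ HasDerivAt
      (fun s : ℝ => (toSphere n (Real.cos s • w + Real.sin s • X w) : Ambient n))
      (c • C.unitTangent (toSphere n (Real.cos t • w + Real.sin t • X w))) t := by
  set m : ℝ → Ambient n := fun s => Real.cos s • w + Real.sin s • X w with hm
  have hm0 : ∀ s, m s ≠ 0 := fun s h => by
    have h1 := hX.comb_eq_zero hw h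
    have := Real.cos_sq_add_sin_sq s
    simp [h1.1, h1.2] at this
  have hm1 : HasDerivAt m (X (m t)) t := by
    have h1 := ((Real.hasDerivAt_cos t).smul_const w).add
      ((Real.hasDerivAt_sin t).smul_const (X w))
    have h2 : X (m t) = -Real.sin t • w + Real.cos t • X w := by
      rw [hm, hX.apply_comb]; module
    rw [h2]
    exact h1
  obtain ⟨μ', hμ⟩ : ∃ μ', HasDerivAt (fun s => ‖m s‖⁻¹) μ' t := by
    have : DifferentiableAt ℝ (fun s => ‖m s‖⁻¹) t :=
      (hm1.differentiableAt.norm ℝ (hm0 t)).inv (norm_ne_zero_iff.2 (hm0 t))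
    exact ⟨_, this.hasDerivAt⟩
  have hγ : (fun s : ℝ => (toSphere n (m s) : Ambient n)) = fun s => ‖m s‖⁻¹ • m s := by
    funext s
    exact coe_toSphere (hm0 s)
  have hd := hμ.smul hm1
  change HasDerivAt (fun s => ‖m s‖⁻¹ • m s) _ t at hd
  rw [← hγ] at hd
  have hpos : C.IsPos (m t) (X (m t)) := hX.isPos_comb hC (by
    have := Real.cos_sq_add_sin_sq t
    nlinarith)
  have hmem : (toSphere n (m t) : Ambient n) ∈ C.plane := by
    rw [coe_toSphere (hm0 t)]; exact C.plane.smul_mem _ hpos.1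
  have hunit : ∀ s, ‖(toSphere n (m s) : Ambient n)‖ = 1 := fun s => by simp
  have hinner := inner_deriv_unit_curve (γ := fun s => (toSphere n (m s) : Ambient n)) hunit hd
  have hvmem : ‖m t‖⁻¹ • X (m t) + μ' • m t ∈ C.plane :=
    C.plane.add_mem (C.plane.smul_mem _ hpos.2.1) (C.plane.smul_mem _ hpos.1)
  have hdec := C.eq_inner_smul_add hmem hvmem (hunit t)
  rw [hinner, zero_smul, zero_add] at hdec
  refine ⟨_, ?_, hdec ▸ hd⟩
  have h2 := (C.isPos_iff _ _).1 hpos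
  have hn : 0 < ‖m t‖⁻¹ := inv_pos.2 (norm_pos_iff.2 (hm0 t))
  have h3 := C.area_comb (m t) (X (m t)) ‖m t‖⁻¹ 0 μ' ‖m t‖⁻¹
  rw [zero_smul, add_zero, add_comm (μ' • m t), ← coe_toSphere (hm0 t)] at h3
  rw [h3]
  have := h2.2.2
  rw [zero_mul, sub_zero]
  positivity

lemma isSmoothLocalTrivialization : IsSmoothLocalTrivialization (fibresOf X)
    {d | 0 < φ.b (X (φ.slice d))} (φ.triv hX) where
  isOpen_base := φ.isOpen_base_triv hX
  source_eq := rfl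
  contMDiffOn := (φ.contMDiff_toSphere_preTriv hX).contMDiffOn
  contMDiffOn_symm := φ.contMDiffOn_inverse_triv hX
  fibre := by
    intro d hd
    have hs := φ.slice_ne_zero d
    obtain ⟨C, hC⟩ := OrientedGreatCircle.exists_isPos (hX.linearIndependent hs)
    refine ⟨C, ⟨_, hs, hC⟩, ?_, fun t => ?_⟩
    · ext x
      constructor
      · rintro ⟨z, rfl⟩
        change (toSphere n (φ.preTriv X (d, z)) : Ambient n) ∈ C.plane
        rw [coe_toSphere (φ.preTriv_ne_zero hX _)]
        exact C.plane.smul_mem _ (C.plane.add_mem (C.plane.smul_mem _ hC.1)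
          (C.plane.smul_mem _ hC.2.1))
      · intro hx
        obtain ⟨α, β, hαβ⟩ := hC.exists_comb (x := (x : Ambient n)) hx
        have hne : (⟨α, β⟩ : ℂ) ≠ 0 := fun h => by
          have h1 : α = 0 := congrArg Complex.re h
          have h2 : β = 0 := congrArg Complex.im h
          rw [h1, h2, zero_smul, zero_smul, add_zero] at hαβ
          exact ne_zero_of_mem_unit_sphere x hαβ
        refine ⟨toCircle ⟨α, β⟩, ?_⟩
        change toSphere n (φ.preTriv X _) = x
        have : φ.preTriv X (d, toCircle ⟨α, β⟩) = ‖(⟨α, β⟩ : ℂ)‖⁻¹ • (x : Ambient n) := by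
          rw [hαβ, preTriv, coe_toCircle hne]
          simp [smul_smul]
        rw [this]
        exact toSphere_smul (inv_pos.2 (norm_pos_iff.2 hne)) x
    · have h := hasDerivAt_triv hX hC hs t
      have hexp : ∀ s : ℝ, φ.triv hX (d, Circle.exp s) =
          toSphere n (Real.cos s • φ.slice d + Real.sin s • X (φ.slice d)) := fun s => by
        change toSphere n (φ.preTriv X _) = _
        simp [preTriv, Circle.coe_exp, Complex.exp_mul_I, Complex.cos_ofReal_re,
          Complex.sin_ofReal_re]
      simpa only [hexp] using h

end PlaneFrame

/-- The circles tangent to a quarter turn field fibre the whole sphere. -/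
lemma IsQuarterTurnField.isSmoothGreatCircleFibration {n : ℕ} {X : Ambient n → Ambient n}
    (hX : IsQuarterTurnField X) : IsSmoothGreatCircleFibration (fibresOf X) Set.univ where
  isOpen := isOpen_univ
  carrier_subset _ _ := Set.subset_univ _
  existsUnique_fibre x _ := hX.existsUnique_fibre x
  locally_trivial := by
    intro x _
    obtain ⟨C, ⟨hC, hx⟩, -⟩ := hX.existsUnique_fibre x
    have hp := hX.isPos_of_mem hC hx (ne_zero_of_mem_unit_sphere x)
    obtain ⟨φ, h1, h2⟩ := C.exists_frame (u := x) hx (by simp)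
    refine ⟨_, φ.triv hX, φ.isSmoothLocalTrivialization hX, ?_⟩
    change 0 < φ.det X x
    rw [← h1, PlaneFrame.det, PlaneFrame.a_e₁, PlaneFrame.b_e₁, one_mul, zero_mul, sub_zero,
      PlaneFrame.b, h1, h2]
    exact hp.2.2

/-! ### Quarter turn fields from uniformly transverse maps -/

/-- A map that expands distances by a factor at least `k` has derivative with the same property. -/
lemma HasFDerivAt.le_norm_apply {V : Type*} [NormedAddCommGroup V] [NormedSpace ℝ V]
    {g : V → V} {A : V →L[ℝ] V} {y : V} (hg : HasFDerivAt g A y) {k : ℝ}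
    (h : ∀ d d', k * ‖d - d'‖ ≤ ‖g d - g d'‖) (v : V) : k * ‖v‖ ≤ ‖A v‖ := by
  have h1 := (hg.hasLineDerivAt v).tendsto_slope_zero.norm
  refine ge_of_tendsto h1 ?_
  filter_upwards [self_mem_nhdsWithin] with t ht
  have ht : t ≠ 0 := ht
  have h2 := h (y + t • v) y
  rw [add_sub_cancel_left, norm_smul] at h2
  rw [norm_smul, norm_inv]
  have h3 : 0 < ‖t‖ := norm_pos_iff.2 ht
  rw [le_inv_mul_iff₀ h3]
  linarith

section ConeMaps

variable {V : Type*} [NormedAddCommGroup V] [NormedSpace ℝ V]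

/-- A smooth map `f : V → V` with `f 0 = 0` such that the planes `span(e₁ + y, e₂ + f y)` are uniformly
transverse to each other, and which agrees with a linear complex structure `J` near infinity. -/
structure IsUniformlyTransverse (f : V → V) (J : V →L[ℝ] V) : Prop where
  contDiff : ContDiff ℝ ∞ f
  map_zero : f 0 = 0
  sq_neg : ∀ v, J (J v) = -v
  eq_at_infinity : ∃ R : ℝ, ∀ y, R ≤ ‖y‖ → f y = J y
  le_norm : ∃ c : ℝ, 0 < c ∧ ∀ (p : ℝ × ℝ) (d d' : V),
    c * ‖p‖ * ‖d - d'‖ ≤ ‖p.1 • (d - d') + p.2 • (f d - f d')‖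

/-- The linear combination `a • id + b • f`, for `p = (a, b)`. -/
def pencil (f : V → V) (p : ℝ × ℝ) (y : V) : V := p.1 • y + p.2 • f y

/-- The solution `y` of `a • y + b • f y = z`, for `p = (a, b)`. This is meaningful where `pencil f p`
is bijective, which for a uniformly transverse `f` means `p ≠ 0`. -/
def pencilInv (f : V → V) (p : ℝ × ℝ) (z : V) : V := Function.invFun (pencil f p) z

namespace IsUniformlyTransverse

variable {f : V → V} {J : V →L[ℝ] V} (hf : IsUniformlyTransverse f J)
include hf

lemma exists_expanding : ∃ c : ℝ, 0 < c ∧ ∀ (p : ℝ × ℝ) (d d' : V),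
    c * ‖p‖ * ‖d - d'‖ ≤ ‖pencil f p d - pencil f p d'‖ := by
  obtain ⟨c, hc, h⟩ := hf.le_norm
  refine ⟨c, hc, fun p d d' => (h p d d').trans_eq ?_⟩
  congr 1
  simp only [pencil]
  module

lemma contDiff_pencil : ContDiff ℝ ∞ (fun q : (ℝ × ℝ) × V => pencil f q.1 q.2) := by
  have h1 : ContDiff ℝ ∞ (fun q : (ℝ × ℝ) × V => f q.2) := hf.contDiff.comp contDiff_snd
  exact (contDiff_fst.fst.smul contDiff_snd).add (contDiff_fst.snd.smul h1)

lemma contDiff_pencil_apply (p : ℝ × ℝ) : ContDiff ℝ ∞ (pencil f p) :=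
  hf.contDiff_pencil.comp (contDiff_const.prodMk contDiff_id)

lemma le_norm_fderiv : ∃ c : ℝ, 0 < c ∧ ∀ (p : ℝ × ℝ) (y v : V),
    c * ‖p‖ * ‖v‖ ≤ ‖fderiv ℝ (pencil f p) y v‖ := by
  obtain ⟨c, hc, h⟩ := hf.exists_expanding
  exact ⟨c, hc, fun p y => (((hf.contDiff_pencil_apply p).differentiable (by simp) y
    ).hasFDerivAt).le_norm_apply (h p)⟩

lemma pencil_injective {p : ℝ × ℝ} (hp : p ≠ 0) : Function.Injective (pencil f p) := by
  intro d d' hd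
  obtain ⟨c, hc, h⟩ := hf.exists_expanding
  have h1 := h p d d'
  rw [hd, sub_self, norm_zero] at h1
  have h2 : 0 < c * ‖p‖ := mul_pos hc (norm_pos_iff.2 hp)
  have h3 : ‖d - d'‖ ≤ 0 := by
    by_contra hcon
    nlinarith
  exact sub_eq_zero.1 (norm_le_zero_iff.1 h3)

variable [FiniteDimensional ℝ V]

/-- The image of `a • id + b • f` is open by the inverse function theorem and closed because the
map is expanding. -/
lemma pencil_surjective {p : ℝ × ℝ} (hp : p ≠ 0) : Function.Surjective (pencil f p) := by
  have hcd := hf.contDiff_pencil_apply p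
  obtain ⟨c, hc, h⟩ := hf.exists_expanding
  obtain ⟨c', hc', h'⟩ := hf.le_norm_fderiv
  have hp0 : 0 < ‖p‖ := norm_pos_iff.2 hp
  have hequiv : ∀ y, ∃ A : V ≃L[ℝ] V, (A : V →L[ℝ] V) = fderiv ℝ (pencil f p) y := by
    intro y
    have hinj : Function.Injective (fderiv ℝ (pencil f p) y).toLinearMap := by
      rw [← LinearMap.ker_eq_bot, LinearMap.ker_eq_bot']
      intro v hv
      have h2 := h' p y v
      have hv : fderiv ℝ (pencil f p) y v = 0 := hv
      rw [hv, norm_zero] at h2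
      have h3 : 0 < c' * ‖p‖ := mul_pos hc' hp0
      exact norm_le_zero_iff.1 (by by_contra hcon; nlinarith)
    exact ⟨(LinearEquiv.ofInjectiveEndo _ hinj).toContinuousLinearEquiv, by ext; rfl⟩
  choose A hA using hequiv
  have hopen : IsOpenMap (pencil f p) := by
    refine isOpenMap_of_hasStrictFDerivAt_equiv (f' := A) fun y => ?_
    rw [hA]
    exact hcd.contDiffAt.hasStrictFDerivAt (by simp)
  have hclosed : IsClosed (Set.range (pencil f p)) := by
    have hanti : AntilipschitzWith (Real.toNNReal (c * ‖p‖)⁻¹) (pencil f p) := by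
      refine AntilipschitzWith.of_le_mul_dist fun d d' => ?_
      rw [dist_eq_norm, dist_eq_norm, Real.coe_toNNReal _ (by positivity),
        le_inv_mul_iff₀ (by positivity)]
      exact h p d d'
    have hprop : IsProperMap (pencil f p) := by
      rw [isProperMap_iff_tendsto_cocompact]
      refine ⟨hcd.continuous, ?_⟩
      rw [← Metric.cobounded_eq_cocompact]
      exact hanti.tendsto_cobounded
    exact hprop.isClosed_range
  have := IsClopen.eq_univ ⟨hclosed, hopen.isOpen_range⟩ (Set.range_nonempty _)
  exact Set.range_eq_univ.1 this

lemma pencil_pencilInv {p : ℝ × ℝ} (hp : p ≠ 0) (z : V) : pencil f p (pencilInv f p z) = z :=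
  Function.rightInverse_invFun (hf.pencil_surjective hp) z

omit [FiniteDimensional ℝ V] in
lemma pencilInv_eq {p : ℝ × ℝ} (hp : p ≠ 0) {y z : V} (h : pencil f p y = z) :
    pencilInv f p z = y := by
  rw [← h]
  exact Function.leftInverse_invFun (hf.pencil_injective hp) y

/-- The solution of `a • y + b • f y = z` depends smoothly on `((a, b), z)`. -/
lemma contDiffAt_pencilInv {q : (ℝ × ℝ) × V} (hq : q.1 ≠ 0) :
    ContDiffAt ℝ ∞ (fun q : (ℝ × ℝ) × V => pencilInv f q.1 q.2) q := by
  set y := pencilInv f q.1 q.2 with hy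
  let Q : (ℝ × ℝ) × V → V := fun q => pencil f q.1 q.2
  let H : (ℝ × ℝ) × V → (ℝ × ℝ) × V := fun q => (q.1, Q q)
  have hH : ContDiff ℝ ∞ H := contDiff_fst.prodMk hf.contDiff_pencil
  have hHq : H (q.1, y) = q := Prod.ext rfl (hf.pencil_pencilInv hq q.2)
  have hQ : HasFDerivAt Q (fderiv ℝ Q (q.1, y)) (q.1, y) :=
    (hf.contDiff_pencil.differentiable (by simp) _).hasFDerivAt
  have hH' : HasFDerivAt H ((ContinuousLinearMap.fst ℝ (ℝ × ℝ) V).prod (fderiv ℝ Q (q.1, y)))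
      (q.1, y) := hasFDerivAt_fst.prodMk hQ
  obtain ⟨c, hc, h⟩ := hf.le_norm_fderiv
  have hpart : ∀ v : V, fderiv ℝ Q (q.1, y) (0, v) = fderiv ℝ (pencil f q.1) y v := by
    intro v
    have h1 : HasFDerivAt (fun y => (q.1, y)) (ContinuousLinearMap.inr ℝ (ℝ × ℝ) V) y :=
      hasFDerivAt_prodMk_right _ _
    have h2 := hQ.comp y h1
    have h3 : fderiv ℝ (pencil f q.1) y = _ := h2.fderiv
    rw [h3]
    rfl
  have hinj : Function.Injective
      ((ContinuousLinearMap.fst ℝ (ℝ × ℝ) V).prod (fderiv ℝ Q (q.1, y))).toLinearMap := by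
    rw [← LinearMap.ker_eq_bot, LinearMap.ker_eq_bot']
    rintro ⟨u, v⟩ huv
    have hu : u = 0 := congrArg Prod.fst huv
    have hv : fderiv ℝ Q (q.1, y) (u, v) = 0 := congrArg Prod.snd huv
    subst hu
    rw [hpart] at hv
    have h2 := h q.1 y v
    rw [hv, norm_zero] at h2
    have h3 : 0 < c * ‖q.1‖ := mul_pos hc (norm_pos_iff.2 hq)
    have hv0 : v = 0 := norm_le_zero_iff.1 (by by_contra hcon; nlinarith)
    rw [hv0]
    rfl
  let A := (LinearEquiv.ofInjectiveEndo _ hinj).toContinuousLinearEquiv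
  have hA : HasFDerivAt H (A : (ℝ × ℝ) × V →L[ℝ] (ℝ × ℝ) × V) (q.1, y) := by
    convert hH' using 1
    ext <;> rfl
  have hn : (∞ : ℕ∞ω) ≠ 0 := by simp
  have hG := hH.contDiffAt.to_localInverse hA hn
  rw [hHq] at hG
  have hright : ∀ᶠ q' in nhds q, H (hH.contDiffAt.localInverse hA hn q') = q' := by
    have := (hH.contDiffAt.hasStrictFDerivAt' hA hn).eventually_right_inverse
    rwa [hHq] at this
  refine hG.snd.congr_of_eventuallyEq ?_
  filter_upwards [hright, continuous_fst.continuousAt.eventually_ne hq] with q' hq' hne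
  refine hf.pencilInv_eq hne ?_
  conv_rhs => rw [← hq']
  have : q'.1 = (hH.contDiffAt.localInverse hA hn q').1 := (congrArg Prod.fst hq').symm
  rw [this]

end IsUniformlyTransverse

end ConeMaps

namespace PlaneFrame

variable {n : ℕ} (φ : PlaneFrame n)
  (f : EuclideanSpace ℝ (Fin (2 * n)) → EuclideanSpace ℝ (Fin (2 * n)))
  (J : EuclideanSpace ℝ (Fin (2 * n)) →L[ℝ] EuclideanSpace ℝ (Fin (2 * n)))

/-- The coordinates of `x` in the plane of the frame. -/
def ab (x : Ambient n) : ℝ × ℝ := (φ.a x, φ.b x)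

/-- The parameter `y` of the plane `span(e₁ + y, e₂ + f y)` containing `x`; it has no meaning where
both coordinates of `x` in the plane of the frame vanish. -/
def param (x : Ambient n) : EuclideanSpace ℝ (Fin (2 * n)) := pencilInv f (φ.ab x) (φ.π x)

/-- The quarter turn field of the planes `span(e₁ + y, e₂ + f y)`, completed by the complex lines
of `J` in the orthogonal complement of the plane of the frame. -/
def graphField (x : Ambient n) : Ambient n :=
  open Classical in
  if φ.ab x = 0 then φ.ι (J (φ.π x)) else
    φ.a x • (φ.e₂ + φ.ι (f (φ.param f x))) - φ.b x • (φ.e₁ + φ.ι (φ.param f x))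

variable {f J} (hf : IsUniformlyTransverse f J)
include hf

lemma param_comb {p : ℝ × ℝ} (hp : p ≠ 0) (y) :
    φ.param f (p.1 • (φ.e₁ + φ.ι y) + p.2 • (φ.e₂ + φ.ι (f y))) = y := by
  rw [param, ab]
  simp only [a_add, a_smul, a_e₁, a_ι, a_e₂, b_add, b_smul, b_e₁, b_ι, b_e₂, map_add, map_smul,
    pi_e₁, pi_e₂, pi_ι, zero_add, add_zero, mul_one, mul_zero]
  exact hf.pencilInv_eq hp rfl

lemma graphField_comb (p : ℝ × ℝ) (y) :
    φ.graphField f J (p.1 • (φ.e₁ + φ.ι y) + p.2 • (φ.e₂ + φ.ι (f y))) =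
      p.1 • (φ.e₂ + φ.ι (f y)) - p.2 • (φ.e₁ + φ.ι y) := by
  by_cases hp : p = 0
  · subst hp
    simp [graphField, ab, a, b]
  · have hab : φ.ab (p.1 • (φ.e₁ + φ.ι y) + p.2 • (φ.e₂ + φ.ι (f y))) = p := by
      rw [ab]
      simp
    rw [graphField, hab, if_neg hp, φ.param_comb hf hp]
    congr 2
    · exact congrArg Prod.fst hab
    · exact congrArg Prod.snd hab

omit hf in
lemma graphField_ι (z) : φ.graphField f J (φ.ι z) = φ.ι (J z) := by
  simp [graphField, ab]

omit hf in
lemma eq_ι_of_ab {x : Ambient n} (h : φ.ab x = 0) : x = φ.ι (φ.π x) := by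
  have h1 : φ.a x = 0 := congrArg Prod.fst h
  have h2 : φ.b x = 0 := congrArg Prod.snd h
  have := φ.eq_coords x
  rwa [h1, h2, zero_smul, zero_smul, zero_add, zero_add] at this

lemma eq_comb_param {x : Ambient n} (h : φ.ab x ≠ 0) :
    x = φ.a x • (φ.e₁ + φ.ι (φ.param f x)) + φ.b x • (φ.e₂ + φ.ι (f (φ.param f x))) := by
  have h1 := hf.pencil_pencilInv h (φ.π x)
  apply φ.ext_coords
  · simp
  · simp
  · simpa [pencil, param, ab] using h1.symm

lemma graphField_apply_comb (x : Ambient n) (α β : ℝ) :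
    φ.graphField f J (α • x + β • φ.graphField f J x) = α • φ.graphField f J x - β • x := by
  by_cases h : φ.ab x = 0
  · obtain ⟨z, rfl⟩ : ∃ z, x = φ.ι z := ⟨_, φ.eq_ι_of_ab h⟩
    rw [graphField_ι, ← map_smul, ← map_smul, ← map_add, graphField_ι, map_add,
      map_smul, map_smul, hf.sq_neg, map_add, map_smul, map_smul, map_neg]
    module
  · obtain ⟨p, y, rfl⟩ : ∃ (p : ℝ × ℝ) (y : EuclideanSpace ℝ (Fin (2 * n))),
        x = p.1 • (φ.e₁ + φ.ι y) + p.2 • (φ.e₂ + φ.ι (f y)) :=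
      ⟨φ.ab x, φ.param f x, φ.eq_comb_param hf h⟩
    have h3 : α • (p.1 • (φ.e₁ + φ.ι y) + p.2 • (φ.e₂ + φ.ι (f y))) +
        β • (p.1 • (φ.e₂ + φ.ι (f y)) - p.2 • (φ.e₁ + φ.ι y)) =
        (α * p.1 - β * p.2) • (φ.e₁ + φ.ι y) + (α * p.2 + β * p.1) • (φ.e₂ + φ.ι (f y)) := by
      module
    rw [φ.graphField_comb hf, h3, φ.graphField_comb hf (α * p.1 - β * p.2, α * p.2 + β * p.1)]
    module

omit hf in
lemma contDiff_ab : ContDiff ℝ ∞ φ.ab := φ.contDiff_a.prodMk φ.contDiff_b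

lemma contDiffAt_param {x : Ambient n} (h : φ.ab x ≠ 0) : ContDiffAt ℝ ∞ (φ.param f) x :=
  ContDiffAt.comp (g := fun q : (ℝ × ℝ) × EuclideanSpace ℝ (Fin (2 * n)) => pencilInv f q.1 q.2)
    x (hf.contDiffAt_pencilInv (q := (φ.ab x, φ.π x)) h) (φ.contDiff_ab.prodMk φ.π.contDiff).contDiffAt

lemma contDiffAt_graphField {x : Ambient n} (hx : x ≠ 0) :
    ContDiffAt ℝ ∞ (φ.graphField f J) x := by
  by_cases h : φ.ab x = 0
  · have hz : 0 < ‖φ.π x‖ := by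
      rw [norm_pos_iff]
      intro h0
      apply hx
      rw [φ.eq_ι_of_ab h, h0, map_zero]
    obtain ⟨R, hR⟩ := hf.eq_at_infinity
    obtain ⟨M, hM⟩ := (isCompact_closedBall (0 : EuclideanSpace ℝ (Fin (2 * n))) R
      ).exists_bound_of_continuousOn hf.contDiff.continuous.continuousOn
    have hlin : ContDiff ℝ ∞ (fun x => φ.ι (J (φ.π x)) + φ.a x • φ.e₂ - φ.b x • φ.e₁) :=
      (((φ.ι.contDiff.comp (J.contDiff.comp φ.π.contDiff)).add
        (φ.contDiff_a.smul contDiff_const))).sub (φ.contDiff_b.smul contDiff_const)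
    refine hlin.contDiffAt.congr_of_eventuallyEq ?_
    have hnear : ∀ᶠ x' in nhds x, |φ.a x'| * R + |φ.b x'| * M < ‖φ.π x'‖ := by
      refine ContinuousAt.eventually_lt ?_ φ.π.continuous.norm.continuousAt ?_
      · exact ((φ.contDiff_a.continuous.abs.mul continuous_const).add
          (φ.contDiff_b.continuous.abs.mul continuous_const)).continuousAt
      · have h1 : φ.a x = 0 := congrArg Prod.fst h
        have h2 : φ.b x = 0 := congrArg Prod.snd h
        simpa [h1, h2] using hz
    filter_upwards [hnear] with x' hx'
    by_cases h' : φ.ab x' = 0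
    · have h1 : φ.a x' = 0 := congrArg Prod.fst h'
      have h2 : φ.b x' = 0 := congrArg Prod.snd h'
      rw [graphField, if_pos h', h1, h2]
      simp
    · have h1 := hf.pencil_pencilInv h' (φ.π x')
      change φ.a x' • φ.param f x' + φ.b x' • f (φ.param f x') = φ.π x' at h1
      -- a small parameter would make the projection of `x'` small
      have hfar : R ≤ ‖φ.param f x'‖ := by
        by_contra hcon
        push Not at hcon
        have h2 := hM (φ.param f x') (by simpa using hcon.le)
        have h3 : ‖φ.π x'‖ ≤ |φ.a x'| * R + |φ.b x'| * M := by
          rw [← h1]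
          refine (norm_add_le _ _).trans ?_
          rw [norm_smul, norm_smul, Real.norm_eq_abs, Real.norm_eq_abs]
          gcongr
        linarith
      rw [graphField, if_neg h']
      rw [← h1, hR _ hfar]
      simp only [map_add, map_smul, hf.sq_neg, map_neg]
      module
  · have h1 : ContDiffAt ℝ ∞ (φ.param f) x := φ.contDiffAt_param hf h
    have h2 : ContDiffAt ℝ ∞ (fun x => φ.a x • (φ.e₂ + φ.ι (f (φ.param f x))) -
        φ.b x • (φ.e₁ + φ.ι (φ.param f x))) x := by
      refine (φ.contDiff_a.contDiffAt.smul (contDiffAt_const.add ?_)).sub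
        (φ.contDiff_b.contDiffAt.smul (contDiffAt_const.add ?_))
      · exact φ.ι.contDiff.contDiffAt.comp x (hf.contDiff.contDiffAt.comp x h1)
      · exact φ.ι.contDiff.contDiffAt.comp x h1
    refine h2.congr_of_eventuallyEq ?_
    filter_upwards [φ.contDiff_ab.continuous.continuousAt.eventually_ne h] with x' hx'
    rw [graphField, if_neg hx']

lemma isQuarterTurnField_graphField : IsQuarterTurnField (φ.graphField f J) where
  contDiffAt _ hx := φ.contDiffAt_graphField hf hx
  apply_comb := φ.graphField_apply_comb hf

lemma isPos_of_mem_fibresOf_graphField {C : OrientedGreatCircle n}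
    (hC : C ∈ fibresOf (φ.graphField f J)) {x : Ambient n} (hx : x ∈ C.plane) (h : φ.ab x ≠ 0) :
    C.IsPos (φ.e₁ + φ.ι (φ.param f x)) (φ.e₂ + φ.ι (f (φ.param f x))) := by
  have h0 : x ≠ 0 := fun h0 => h (by simp [h0, ab, a, b])
  have h1 := (φ.isQuarterTurnField_graphField hf).isPos_of_mem hC hx h0
  obtain ⟨p, y, hp, rfl⟩ : ∃ (p : ℝ × ℝ) (y : EuclideanSpace ℝ (Fin (2 * n))), p ≠ 0 ∧
      x = p.1 • (φ.e₁ + φ.ι y) + p.2 • (φ.e₂ + φ.ι (f y)) :=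
    ⟨φ.ab x, φ.param f x, h, φ.eq_comb_param hf h⟩
  rw [φ.param_comb hf hp]
  rw [φ.graphField_comb hf] at h1
  have hpos : 0 < p.1 * p.1 + p.2 * p.2 := by
    by_contra hcon
    have h1 : p.1 = 0 := by nlinarith
    have h2 : p.2 = 0 := by nlinarith
    exact hp (Prod.ext h1 h2)
  have hinv : (p.1 * p.1 + p.2 * p.2)⁻¹ * (p.1 * p.1 + p.2 * p.2) = 1 := inv_mul_cancel₀ hpos.ne'
  set N := (p.1 * p.1 + p.2 * p.2)⁻¹ with hN
  have hN0 : 0 < N := inv_pos.2 hpos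
  have h2 := h1.comb (a := N * p.1) (b := -(N * p.2)) (c := N * p.2) (d := N * p.1) (by
      have : N * p.1 * (N * p.1) - -(N * p.2) * (N * p.2) =
        N * (N * (p.1 * p.1 + p.2 * p.2)) := by ring
      rw [this, hinv, mul_one]
      exact hN0)
  convert h2 using 1
  · have h3 : φ.e₁ + φ.ι y = (N * (p.1 * p.1 + p.2 * p.2)) • (φ.e₁ + φ.ι y) := by
      rw [hinv, one_smul]
    refine h3.trans ?_
    clear_value N
    module
  · have h3 : φ.e₂ + φ.ι (f y) = (N * (p.1 * p.1 + p.2 * p.2)) • (φ.e₂ + φ.ι (f y)) := by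
      rw [hinv, one_smul]
    refine h3.trans ?_
    clear_value N
    module

end PlaneFrame

/-! ### Linear maps without real eigenvalues -/

section ComplexStructure

open Polynomial

/-- A monic real polynomial without real roots is, over `ℂ`, the product of a polynomial `q` with
roots in the upper half plane and of its complex conjugate. -/
lemma Polynomial.exists_map_eq_mul_conj {m : ℝ[X]} (hm : m.Monic) (hroot : ∀ x : ℝ, m.eval x ≠ 0) :
    ∃ q : ℂ[X], m.map (algebraMap ℝ ℂ) = q * q.map (starRingEnd ℂ) ∧
      ∀ z : ℂ, q.eval z = 0 → 0 < z.im := by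
  set mC := m.map (algebraMap ℝ ℂ) with hmC
  have hmon : mC.Monic := hm.map _
  have hsplit : mC.Splits := IsAlgClosed.splits mC
  have hconj : mC.map (starRingEnd ℂ) = mC := by
    rw [hmC, Polynomial.map_map]
    congr 1
    ext x
    exact Complex.conj_ofReal x
  have hroots : mC.roots.map (starRingEnd ℂ) = mC.roots := by
    rw [← hsplit.roots_map (starRingEnd ℂ), hconj]
  have him : ∀ z ∈ mC.roots, z.im ≠ 0 := by
    intro z hz h0
    apply hroot z.re
    have h1 : mC.eval z = 0 := (mem_roots'.1 hz).2
    have h2 : z = algebraMap ℝ ℂ z.re := Complex.ext rfl (by simpa using h0)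
    rw [h2, hmC, eval_map_apply] at h1
    exact (algebraMap ℝ ℂ).injective (by rw [h1, map_zero])
  set q : ℂ[X] := ((mC.roots.filter fun z => 0 < z.im).map fun z => X - C z).prod with hq
  refine ⟨q, ?_, ?_⟩
  · have h1 : q.map (starRingEnd ℂ) =
        ((mC.roots.filter fun z => ¬ 0 < z.im).map fun z => X - C z).prod := by
      have h2 : mC.roots.filter (fun z => ¬ 0 < z.im) =
          (mC.roots.filter fun z => 0 < z.im).map (starRingEnd ℂ) := by
        conv_lhs => rw [← hroots]
        rw [Multiset.filter_map]
        congr 1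
        refine Multiset.filter_congr fun z hz => ?_
        have := him z hz
        simp only [Function.comp, Complex.conj_im, not_lt, Left.neg_nonpos_iff]
        exact ⟨fun h => lt_of_le_of_ne h this.symm, le_of_lt⟩
      rw [h2, hq, Polynomial.map_multiset_prod, Multiset.map_map, Multiset.map_map]
      simp
    rw [h1, hq, ← Multiset.prod_add, ← Multiset.map_add, Multiset.filter_add_not]
    exact hsplit.eq_prod_roots_of_monic hmon
  · intro z hz
    rw [hq, eval_multiset_prod, Multiset.prod_eq_zero_iff, Multiset.map_map, Multiset.mem_map] at hz
    obtain ⟨w, hw, hwz⟩ := hz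
    have : z = w := by simpa [sub_eq_zero] using hwz
    rw [this]
    exact (Multiset.mem_filter.1 hw).2

/-- For a monic real polynomial `m` without real roots there is a real polynomial `p` which is a
square root of `-1` modulo `m`, with values `± i` at the roots of `m` in the upper and lower half
planes respectively. -/
lemma Polynomial.exists_sq_add_one_dvd {m : ℝ[X]} (hm : m.Monic) (hroot : ∀ x : ℝ, m.eval x ≠ 0) :
    ∃ p : ℝ[X], m ∣ p ^ 2 + 1 ∧ ∀ z : ℂ, aeval z m = 0 →
      (0 < z.im ∧ aeval z p = Complex.I) ∨ (z.im < 0 ∧ aeval z p = -Complex.I) := by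
  obtain ⟨q, hq, hpos⟩ := exists_map_eq_mul_conj hm hroot
  have hcc : (starRingEnd ℂ).comp (starRingEnd ℂ) = RingHom.id ℂ := RingHom.ext Complex.conj_conj
  set r := q.map (starRingEnd ℂ) with hr
  have hrr : r.map (starRingEnd ℂ) = q := by
    rw [hr, Polynomial.map_map, hcc]
    exact Polynomial.map_id
  have hneg : ∀ z : ℂ, r.eval z = 0 → z.im < 0 := by
    intro z hz
    have h1 : q.eval (starRingEnd ℂ z) = 0 := by
      rw [← hrr, eval_map_apply, hz, map_zero]
    have := hpos _ h1
    simpa using this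
  have hcop : IsCoprime q r := by
    rw [isCoprime_iff_aeval_ne_zero_of_isAlgClosed _ ℂ]
    intro z
    by_contra! hcon
    exact lt_asymm (hpos z (by simpa using hcon.1)) (hneg z (by simpa using hcon.2))
  obtain ⟨u, v, huv⟩ := hcop
  -- `P` is `i` modulo `q` and `-i` modulo `r`; so is its conjugate, hence also its real part `p`
  set P : ℂ[X] := C Complex.I * (v * r - u * q) with hP
  set Pc := P.map (starRingEnd ℂ) with hPc
  have hP1 : q ∣ P - C Complex.I := by
    refine ⟨-(C Complex.I * 2 * u), ?_⟩
    linear_combination (C Complex.I) * huv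
  have hP2 : r ∣ P + C Complex.I := by
    refine ⟨C Complex.I * 2 * v, ?_⟩
    linear_combination (-C Complex.I) * huv
  have hP3 : r ∣ Pc + C Complex.I := by
    have := Polynomial.map_dvd (starRingEnd ℂ) hP1
    simpa [hPc, hr] using this
  have hP4 : q ∣ Pc - C Complex.I := by
    have := Polynomial.map_dvd (starRingEnd ℂ) hP2
    rw [hrr] at this
    simpa [hPc, sub_eq_add_neg] using this
  obtain ⟨p, hp⟩ : ∃ p : ℝ[X], p.map (algebraMap ℝ ℂ) = C (1 / 2) * (P + Pc) := by
    have : C (1 / 2 : ℂ) * (P + Pc) ∈ lifts (algebraMap ℝ ℂ) := by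
      rw [lifts_iff_coeff_lifts]
      intro k
      refine ⟨(P.coeff k).re, ?_⟩
      rw [coeff_C_mul (P + Pc), coeff_add, hPc, coeff_map, Complex.add_conj]
      simp
    exact (mem_lifts _).1 this
  have hC : (2 : ℂ[X]) * C (1 / 2) = 1 := by
    rw [show (2 : ℂ[X]) = C 2 from rfl, ← C_mul]; simp
  have hp1 : q ∣ p.map (algebraMap ℝ ℂ) - C Complex.I := by
    obtain ⟨s, hs⟩ := hP1
    obtain ⟨t, ht⟩ := hP4
    refine ⟨C (1 / 2) * (s + t), ?_⟩
    rw [hp]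
    linear_combination C (1 / 2) * hs + C (1 / 2) * ht + C Complex.I * hC
  have hp2 : r ∣ p.map (algebraMap ℝ ℂ) + C Complex.I := by
    obtain ⟨s, hs⟩ := hP2
    obtain ⟨t, ht⟩ := hP3
    refine ⟨C (1 / 2) * (s + t), ?_⟩
    rw [hp]
    linear_combination C (1 / 2) * hs + C (1 / 2) * ht - C Complex.I * hC
  refine ⟨p, ?_, ?_⟩
  · rw [← map_dvd_map' (algebraMap ℝ ℂ), hq]
    have hI : (C Complex.I : ℂ[X]) ^ 2 = -1 := by
      rw [← C_pow, Complex.I_sq]; simp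
    have : (p ^ 2 + 1).map (algebraMap ℝ ℂ) =
        (p.map (algebraMap ℝ ℂ) - C Complex.I) * (p.map (algebraMap ℝ ℂ) + C Complex.I) := by
      rw [Polynomial.map_add, Polynomial.map_pow, Polynomial.map_one]
      linear_combination hI
    rw [this]
    exact mul_dvd_mul hp1 hp2
  · intro z hz
    rw [← eval_map_algebraMap, hq, eval_mul, mul_eq_zero] at hz
    rw [← eval_map_algebraMap]
    rcases hz with hz | hz
    · left
      refine ⟨hpos z hz, ?_⟩
      obtain ⟨s, hs⟩ := hp1
      have := congrArg (eval z) hs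
      rw [eval_mul, hz, zero_mul, eval_sub, eval_C] at this
      exact sub_eq_zero.1 this
    · right
      refine ⟨hneg z hz, ?_⟩
      obtain ⟨s, hs⟩ := hp2
      have := congrArg (eval z) hs
      rw [eval_mul, hz, zero_mul, eval_add, eval_C] at this
      exact eq_neg_of_add_eq_zero_left this

/-- A linear map `T` without real eigenvalues can be joined to a complex structure `J` by a segment
of linear maps without real eigenvalues. The map `J` acts as `i` on the generalized eigenspaces of
`T` for the eigenvalues in the upper half plane, and as `-i` on the others. -/
lemma exists_complexStructure {V : Type*} [AddCommGroup V] [Module ℝ V] [FiniteDimensional ℝ V]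
    (T : V →ₗ[ℝ] V) (hT : ∀ (c : ℝ) (v : V), T v = c • v → v = 0) :
    ∃ J : V →ₗ[ℝ] V, (∀ v, J (J v) = -v) ∧ ∀ t ∈ Set.Icc (0 : ℝ) 1, ∀ p : ℝ × ℝ, p ≠ 0 →
      ∀ v, p.1 • v + p.2 • (T v + t • (J v - T v)) = 0 → v = 0 := by
  have hroot : ∀ x : ℝ, T.charpoly.eval x ≠ 0 := by
    intro x hx
    have h1 : Module.End.HasEigenvalue T x :=
      (Module.End.hasEigenvalue_iff_isRoot_charpoly T x).2 hx
    obtain ⟨v, hv⟩ := h1.exists_hasEigenvector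
    exact hv.2 (hT x v hv.apply_eq_smul)
  obtain ⟨p, hdvd, hval⟩ := exists_sq_add_one_dvd T.charpoly_monic hroot
  refine ⟨aeval T p, fun v => ?_, fun t ht c hc v hv => ?_⟩
  · obtain ⟨s, hs⟩ := hdvd
    have h1 := congrArg (aeval T) hs
    rw [map_mul, LinearMap.aeval_self_charpoly, zero_mul, map_add, map_pow, map_one] at h1
    have h2 := LinearMap.congr_fun h1 v
    rw [pow_two] at h2
    exact eq_neg_of_add_eq_zero_left h2
  · have hcop : IsCoprime T.charpoly (C c.1 + C c.2 * (X + C t * (p - X))) := by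
      rw [isCoprime_iff_aeval_ne_zero_of_isAlgClosed _ ℂ]
      intro z
      by_contra! hcon
      obtain ⟨h1, h2⟩ := hcon
      simp only [map_add, map_mul, map_sub, aeval_C, aeval_X, Complex.coe_algebraMap] at h2
      have him := congrArg Complex.im h2
      have hre := congrArg Complex.re h2
      have hc2 : c.2 = 0 := by
        rcases hval z h1 with ⟨hz, hp⟩ | ⟨hz, hp⟩
        · rw [hp] at him
          simp at him
          refine him.resolve_right fun h => ?_
          have h3 := mul_nonneg (sub_nonneg.2 ht.2) hz.le
          have h4 : t = 0 := le_antisymm (by linarith) ht.1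
          rw [h4] at h
          linarith
        · rw [hp] at him
          simp at him
          refine him.resolve_right fun h => ?_
          have h3 := mul_nonneg (sub_nonneg.2 ht.2) (neg_nonneg.2 hz.le)
          have h4 : t = 0 := le_antisymm (by linarith) ht.1
          rw [h4] at h
          linarith
      rw [hc2] at hre
      simp at hre
      exact hc (Prod.ext hre hc2)
    obtain ⟨u, w, huw⟩ := hcop
    have h1 := congrArg (aeval T) huw
    rw [map_add, map_mul, LinearMap.aeval_self_charpoly, mul_zero, zero_add, map_mul, map_one] at h1
    have h2 := LinearMap.congr_fun h1 v
    have h3 : aeval T (C c.1 + C c.2 * (X + C t * (p - X))) v = 0 := by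
      rw [← hv]
      simp [Algebra.algebraMap_eq_smul_one]
    rw [Module.End.mul_apply, h3, map_zero] at h2
    exact h2.symm

end ComplexStructure

/-! ### Extension of germs to uniformly transverse maps -/

section Interpolation

lemma Real.smoothTransition.exists_lipschitz :
    ∃ M : ℝ, 0 ≤ M ∧ ∀ x y : ℝ, |smoothTransition x - smoothTransition y| ≤ M * |x - y| := by
  have hcd : ContDiff ℝ 1 smoothTransition := smoothTransition.contDiff (n := 1)
  obtain ⟨M, hM⟩ := (isCompact_Icc (a := (0 : ℝ)) (b := 1)).exists_bound_of_continuousOn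
    (hcd.continuous_deriv le_rfl).continuousOn
  have hM0 : 0 ≤ M := (norm_nonneg _).trans (hM 0 (by simp))
  refine ⟨M, hM0, fun x y => ?_⟩
  rw [← smoothTransition.projIcc (x := x), ← smoothTransition.projIcc (x := y)]
  have h1 := (convex_Icc (0 : ℝ) 1).norm_image_sub_le_of_norm_deriv_le (f := smoothTransition)
    (fun z _ => hcd.differentiable (by simp) z) hM (Set.projIcc (0 : ℝ) 1 zero_le_one y).2
    (Set.projIcc (0 : ℝ) 1 zero_le_one x).2
  rw [Real.norm_eq_abs, Real.norm_eq_abs] at h1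
  exact h1.trans (mul_le_mul_of_nonneg_left (Set.abs_projIcc_sub_projIcc _) hM0)

variable {V : Type*} [NormedAddCommGroup V] [InnerProductSpace ℝ V]

/-- A radial cutoff function which passes slowly, on a logarithmic scale, from the value `0` on the
ball of radius `s` to the value `1` outside the ball of radius `s * exp κ⁻¹`. At the origin
`Real.log 0 = 0` gives the correct value `0`. -/
def logCutoff (κ s : ℝ) (d : V) : ℝ := Real.smoothTransition (κ * Real.log (‖d‖ / s))

variable {κ s : ℝ}

omit [InnerProductSpace ℝ V] in
lemma logCutoff_mem_Icc (d : V) : logCutoff κ s d ∈ Set.Icc (0 : ℝ) 1 :=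
  ⟨Real.smoothTransition.nonneg _, Real.smoothTransition.le_one _⟩

omit [InnerProductSpace ℝ V] in
lemma logCutoff_eq_zero (hκ : 0 < κ) (hs : 0 < s) {d : V} (hd : ‖d‖ ≤ s) :
    logCutoff κ s d = 0 := by
  refine Real.smoothTransition.zero_of_nonpos (mul_nonpos_of_nonneg_of_nonpos hκ.le ?_)
  exact Real.log_nonpos (by positivity) ((div_le_one hs).2 hd)

omit [InnerProductSpace ℝ V] in
lemma logCutoff_eq_one (hκ : 0 < κ) (hs : 0 < s) {d : V} (hd : s * Real.exp κ⁻¹ ≤ ‖d‖) :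
    logCutoff κ s d = 1 := by
  refine Real.smoothTransition.one_of_one_le ?_
  have h1 : Real.exp κ⁻¹ ≤ ‖d‖ / s := by rw [le_div_iff₀ hs]; linarith
  have h2 := Real.log_le_log (Real.exp_pos _) h1
  rw [Real.log_exp] at h2
  calc 1 = κ * κ⁻¹ := (mul_inv_cancel₀ hκ.ne').symm
    _ ≤ _ := by gcongr

lemma contDiff_logCutoff (hκ : 0 < κ) (hs : 0 < s) :
    ContDiff ℝ ∞ (logCutoff κ s : V → ℝ) := by
  rw [contDiff_iff_contDiffAt]
  intro d
  by_cases hd : d = 0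
  · refine (contDiffAt_const (c := (0 : ℝ))).congr_of_eventuallyEq ?_
    filter_upwards [Metric.ball_mem_nhds d hs] with d' hd'
    subst hd
    exact logCutoff_eq_zero hκ hs (mem_ball_zero_iff.1 hd').le
  · have h1 : ‖d‖ / s ≠ 0 := (div_pos (norm_pos_iff.2 hd) hs).ne'
    exact Real.smoothTransition.contDiffAt.comp d
      (contDiffAt_const.mul (((contDiffAt_norm ℝ hd).div_const s).log h1))

omit [InnerProductSpace ℝ V] in
/-- The radial derivative of the cutoff function at `d` is of order `κ / ‖d‖`. In this form of the
estimate it controls the variation of the cutoff in the product with a map of linear growth. -/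
lemma exists_logCutoff_sub_mul_norm_le : ∃ M : ℝ, 0 ≤ M ∧ ∀ κ s : ℝ, 0 < κ → 0 < s →
    ∀ d d' : V, ‖d‖ ≤ ‖d'‖ →
      |logCutoff κ s d - logCutoff κ s d'| * ‖d‖ ≤ M * κ * ‖d - d'‖ := by
  obtain ⟨M, hM0, hM⟩ := Real.smoothTransition.exists_lipschitz
  refine ⟨M, hM0, fun κ s hκ hs d d' hd => ?_⟩
  rcases eq_or_ne d 0 with rfl | hd0
  · simp only [norm_zero, mul_zero]
    positivity
  have hpos : 0 < ‖d‖ := norm_pos_iff.2 hd0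
  have hpos' : 0 < ‖d'‖ := hpos.trans_le hd
  have h1 : Real.log (‖d'‖ / s) - Real.log (‖d‖ / s) ≤ (‖d'‖ - ‖d‖) / ‖d‖ := by
    rw [← Real.log_div (by positivity) (by positivity)]
    refine (Real.log_le_sub_one_of_pos (by positivity)).trans_eq ?_
    field_simp
  have h2 : Real.log (‖d‖ / s) ≤ Real.log (‖d'‖ / s) :=
    Real.log_le_log (by positivity) (by gcongr)
  have h3 : |logCutoff κ s d - logCutoff κ s d'| ≤ M * (κ * ((‖d'‖ - ‖d‖) / ‖d‖)) := by
    refine (hM _ _).trans ?_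
    rw [← mul_sub, abs_mul, abs_of_pos hκ, abs_sub_comm, abs_of_nonneg (sub_nonneg.2 h2)]
    gcongr
  calc |logCutoff κ s d - logCutoff κ s d'| * ‖d‖
      ≤ M * (κ * ((‖d'‖ - ‖d‖) / ‖d‖)) * ‖d‖ := by gcongr
    _ = M * κ * (‖d'‖ - ‖d‖) := by field_simp
    _ ≤ M * κ * ‖d - d'‖ := by
      gcongr
      rw [norm_sub_rev]
      exact norm_sub_norm_le _ _

/-- The transversality of a segment of linear maps without real eigenvalues is uniform. -/
lemma exists_uniform_transversality [FiniteDimensional ℝ V] (T S : V →L[ℝ] V)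
    (h : ∀ t ∈ Set.Icc (0 : ℝ) 1, ∀ p : ℝ × ℝ, p ≠ 0 →
      ∀ v, p.1 • v + p.2 • (T v + t • S v) = 0 → v = 0) :
    ∃ c : ℝ, 0 < c ∧ ∀ t ∈ Set.Icc (0 : ℝ) 1, ∀ (p : ℝ × ℝ) (v : V),
      c * ‖p‖ * ‖v‖ ≤ ‖p.1 • v + p.2 • (T v + t • S v)‖ := by
  let K : Set (ℝ × (ℝ × ℝ) × V) :=
    Set.Icc 0 1 ×ˢ (Metric.sphere 0 1 ×ˢ Metric.sphere 0 1)
  have hK : IsCompact K := isCompact_Icc.prod ((isCompact_sphere _ _).prod (isCompact_sphere _ _))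
  have hcont : Continuous fun q : ℝ × (ℝ × ℝ) × V =>
      ‖q.2.1.1 • q.2.2 + q.2.1.2 • (T q.2.2 + q.1 • S q.2.2)‖ := by fun_prop
  obtain ⟨c, hc, hcK⟩ := hK.exists_forall_le' hcont.continuousOn (a := 0) (by
    rintro ⟨t, p, v⟩ ⟨ht, hp, hv⟩
    refine norm_pos_iff.2 fun h0 => ?_
    have hp : p ≠ 0 := ne_zero_of_mem_unit_sphere ⟨p, hp⟩
    have hv : v ≠ 0 := ne_zero_of_mem_unit_sphere ⟨v, hv⟩
    exact hv (h t ht p hp v h0))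
  refine ⟨c, hc, fun t ht p v => ?_⟩
  by_cases hp : p = 0
  · simp [hp]
  by_cases hv : v = 0
  · simp [hv]
  have hp0 : 0 < ‖p‖ := norm_pos_iff.2 hp
  have hv0 : 0 < ‖v‖ := norm_pos_iff.2 hv
  have h1 := hcK (t, ‖p‖⁻¹ • p, ‖v‖⁻¹ • v) ⟨ht, by simp [norm_smul, hp0.ne'],
    by simp [norm_smul, hv0.ne']⟩
  have h2 : (‖p‖⁻¹ • p).1 • (‖v‖⁻¹ • v) + (‖p‖⁻¹ • p).2 • (T (‖v‖⁻¹ • v) + t • S (‖v‖⁻¹ • v)) =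
      (‖p‖⁻¹ * ‖v‖⁻¹) • (p.1 • v + p.2 • (T v + t • S v)) := by
    simp only [Prod.smul_fst, Prod.smul_snd, map_smul, smul_eq_mul]
    module
  simp only at h1
  rw [h2, norm_smul, Real.norm_of_nonneg (by positivity), ← mul_inv,
    le_inv_mul_iff₀ (by positivity)] at h1
  linarith

/-- A germ at `0` of a smooth map whose derivative has no real eigenvalues extends to a map that is
uniformly transverse and equals a linear complex structure near infinity. Close to the origin the
map is deformed to its derivative `T`, then `T` is deformed to a complex structure so slowly in the
radial direction that transversality is preserved. -/
lemma exists_isUniformlyTransverse [FiniteDimensional ℝ V] {f : V → V} {r : ℝ} (hr : 0 < r)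
    (hf : ContDiffOn ℝ ∞ f (Metric.ball 0 r)) (hf0 : f 0 = 0)
    (hT : ∀ (c : ℝ) (v : V), fderiv ℝ f 0 v = c • v → v = 0) :
    ∃ (F : V → V) (J : V →L[ℝ] V), IsUniformlyTransverse F J ∧
      ∃ r' : ℝ, 0 < r' ∧ r' ≤ r ∧ ∀ y, ‖y‖ < r' → F y = f y := by
  set T := fderiv ℝ f 0 with hTdef
  obtain ⟨J', hJ'sq, hJ'⟩ := exists_complexStructure T.toLinearMap hT
  set J : V →L[ℝ] V := LinearMap.toContinuousLinearMap J'
  obtain ⟨c, hc, hcle⟩ := exists_uniform_transversality T (J - T) (fun t ht p hp v hv =>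
    hJ' t ht p hp v hv)
  obtain ⟨M, hM0, hM⟩ := exists_logCutoff_sub_mul_norm_le (V := V)
  -- the difference of `f` and `T` has a small Lipschitz constant `η` near the origin
  set η : ℝ := c / (4 * (M + 1)) with hη
  have hη0 : 0 < η := by positivity
  have hηc : (M + 1) * η = c / 4 := by rw [hη]; field_simp
  obtain ⟨r₁, hr₁, hr₁r, hlip⟩ : ∃ r₁ : ℝ, 0 < r₁ ∧ r₁ ≤ r ∧ ∀ d d' : V, ‖d‖ < r₁ → ‖d'‖ < r₁ →
      ‖(f d - T d) - (f d' - T d')‖ ≤ η * ‖d - d'‖ := by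
    have hstrict : HasStrictFDerivAt f T 0 :=
      (hf.contDiffAt (Metric.ball_mem_nhds _ hr)).hasStrictFDerivAt (by simp)
    obtain ⟨U, hU, hUlip⟩ := hstrict.approximates_deriv_on_nhds (c := ⟨η, hη0.le⟩)
      (Or.inr hη0)
    obtain ⟨ε, hε, hεU⟩ := Metric.mem_nhds_iff.1 hU
    refine ⟨min ε r, lt_min hε hr, min_le_right _ _, fun d d' hd hd' => ?_⟩
    have h1 := hUlip d (hεU (by simpa using hd.trans_le (min_le_left _ _)))
      d' (hεU (by simpa using hd'.trans_le (min_le_left _ _)))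
    rw [map_sub] at h1
    refine (le_of_eq ?_).trans h1
    congr 1
    abel
  have hsmall : ∀ d : V, ‖d‖ < r₁ → ‖f d - T d‖ ≤ η * ‖d‖ := fun d hd => by
    simpa [hf0] using hlip d 0 hd (by simpa using hr₁)
  -- with this `s` the cutoff from `f` to `T` ends at radius `r₁ / 2`, inside the domain of `f`
  set s : ℝ := r₁ / 2 * (Real.exp 1)⁻¹ with hs
  have hs0 : 0 < s := by positivity
  -- the rate `κ` of the passage from `T` to `J` uses up at most a quarter of the constant `c`
  set κ : ℝ := c / (4 * (M * ‖J - T‖ + 1)) with hκ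
  have hκ0 : 0 < κ := by positivity
  have hκc : M * κ * ‖J - T‖ ≤ c / 4 := by
    have : (M * ‖J - T‖ + 1) * κ = c / 4 := by rw [hκ]; field_simp
    nlinarith
  have hone : ∀ d : V, r₁ / 2 ≤ ‖d‖ → logCutoff 1 s d = 1 := fun d hd => by
    refine logCutoff_eq_one one_pos hs0 ?_
    rw [inv_one, hs, inv_mul_cancel_right₀ (Real.exp_pos 1).ne']
    exact hd
  set k : V → V := fun d => (1 - logCutoff 1 s d) • (f d - T d) with hk
  have hk0 : ∀ d : V, r₁ / 2 ≤ ‖d‖ → k d = 0 := fun d hd => by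
    rw [hk]; simp only; rw [hone d hd, sub_self, zero_smul]
  have hkcd : ContDiff ℝ ∞ k := by
    rw [contDiff_iff_contDiffAt]
    intro d
    by_cases hd : ‖d‖ < r₁
    · have h1 : ContDiffAt ℝ ∞ f d := hf.contDiffAt
        (Metric.isOpen_ball.mem_nhds (by simpa using hd.trans_le hr₁r))
      exact (contDiffAt_const.sub (contDiff_logCutoff one_pos hs0).contDiffAt).smul
        (h1.sub T.contDiff.contDiffAt)
    · refine (contDiffAt_const (c := (0 : V))).congr_of_eventuallyEq ?_
      have h1 : r₁ / 2 < ‖d‖ := by linarith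
      filter_upwards [continuous_norm.continuousAt.eventually_const_lt h1] with d' hd'
      exact hk0 d' hd'.le
  have hklip : ∀ d d' : V, ‖d‖ ≤ ‖d'‖ → ‖k d - k d'‖ ≤ c / 4 * ‖d - d'‖ := by
    intro d d' hdd
    by_cases hd : ‖d‖ < r₁
    · have h1 : k d - k d' = (logCutoff 1 s d' - logCutoff 1 s d) • (f d - T d) +
          (1 - logCutoff 1 s d') • ((f d - T d) - (f d' - T d')) := by
        simp only [hk]; module
      have h2 : ‖(logCutoff 1 s d' - logCutoff 1 s d) • (f d - T d)‖ ≤ M * η * ‖d - d'‖ := by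
        rw [norm_smul, Real.norm_eq_abs, abs_sub_comm]
        calc _ ≤ |logCutoff 1 s d - logCutoff 1 s d'| * (η * ‖d‖) := by
              gcongr; exact hsmall d hd
          _ = η * (|logCutoff 1 s d - logCutoff 1 s d'| * ‖d‖) := by ring
          _ ≤ η * (M * 1 * ‖d - d'‖) := by exact mul_le_mul_of_nonneg_left (hM 1 s one_pos hs0 d d' hdd) hη0.le
          _ = _ := by ring
      have h3 : ‖(1 - logCutoff 1 s d') • ((f d - T d) - (f d' - T d'))‖ ≤ η * ‖d - d'‖ := by
        by_cases hd' : ‖d'‖ < r₁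
        · rw [norm_smul]
          have h4 := logCutoff_mem_Icc (κ := 1) (s := s) d'
          have h5 : ‖1 - logCutoff 1 s d'‖ ≤ 1 := by
            rw [Real.norm_of_nonneg (by linarith [h4.2])]
            linarith [h4.1]
          calc _ ≤ 1 * (η * ‖d - d'‖) := by gcongr; exact hlip d d' hd hd'
            _ = _ := one_mul _
        · rw [hone d' (by linarith), sub_self, zero_smul, norm_zero]
          positivity
      rw [h1, ← hηc]
      refine (norm_add_le _ _).trans ?_
      linarith
    · rw [hk0 d (by linarith), hk0 d' (by linarith), sub_self, norm_zero]
      positivity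
  set F : V → V := fun d => T d + logCutoff κ 1 d • (J - T) d + k d with hF
  have hFcd : ContDiff ℝ ∞ F := (T.contDiff.add
    ((contDiff_logCutoff hκ0 one_pos).smul (J - T).contDiff)).add hkcd
  -- differences of `F` are close to those of the map on the segment from `T` to `J` that belongs
  -- to the farther point
  have hFdiff : ∀ d d' : V, ‖d‖ ≤ ‖d'‖ →
      ‖(F d - F d') - (T (d - d') + logCutoff κ 1 d' • (J - T) (d - d'))‖ ≤
        c / 2 * ‖d - d'‖ := by
    intro d d' hdd
    have h1 : (F d - F d') - (T (d - d') + logCutoff κ 1 d' • (J - T) (d - d')) =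
        (logCutoff κ 1 d - logCutoff κ 1 d') • (J - T) d + (k d - k d') := by
      simp only [hF, map_sub]; module
    have h2 : ‖(logCutoff κ 1 d - logCutoff κ 1 d') • (J - T) d‖ ≤ c / 4 * ‖d - d'‖ := by
      rw [norm_smul, Real.norm_eq_abs]
      calc _ ≤ |logCutoff κ 1 d - logCutoff κ 1 d'| * (‖J - T‖ * ‖d‖) := by
            gcongr; exact (J - T).le_opNorm d
        _ = ‖J - T‖ * (|logCutoff κ 1 d - logCutoff κ 1 d'| * ‖d‖) := by ring
        _ ≤ ‖J - T‖ * (M * κ * ‖d - d'‖) := by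
            exact mul_le_mul_of_nonneg_left (hM κ 1 hκ0 one_pos d d' hdd) (norm_nonneg _)
        _ = (M * κ * ‖J - T‖) * ‖d - d'‖ := by ring
        _ ≤ _ := by gcongr
    rw [h1]
    refine (norm_add_le _ _).trans ?_
    linarith [hklip d d' hdd]
  have hnear : ∀ y : V, ‖y‖ < min 1 s → F y = f y := by
    intro y hy
    have h1 : logCutoff κ 1 y = 0 :=
      logCutoff_eq_zero hκ0 one_pos (hy.le.trans (min_le_left _ _))
    have h2 : logCutoff 1 s y = 0 :=
      logCutoff_eq_zero one_pos hs0 (hy.le.trans (min_le_right _ _))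
    simp only [hF, hk, h1, h2]
    module
  have hFle : ∀ (p : ℝ × ℝ) (d d' : V), ‖d‖ ≤ ‖d'‖ →
      c / 2 * ‖p‖ * ‖d - d'‖ ≤ ‖p.1 • (d - d') + p.2 • (F d - F d')‖ := by
    intro p d d' hdd
    have h1 := hcle _ (logCutoff_mem_Icc (κ := κ) (s := 1) d') p (d - d')
    have h2 := hFdiff d d' hdd
    have h3 : p.1 • (d - d') + p.2 • (T (d - d') + logCutoff κ 1 d' • (J - T) (d - d')) =
        (p.1 • (d - d') + p.2 • (F d - F d')) -
        p.2 • ((F d - F d') - (T (d - d') + logCutoff κ 1 d' • (J - T) (d - d'))) := by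
      module
    have h4 : |p.2| ≤ ‖p‖ := norm_snd_le p
    have h5 : ‖p.2 • ((F d - F d') - (T (d - d') + logCutoff κ 1 d' • (J - T) (d - d')))‖ ≤
        ‖p‖ * (c / 2 * ‖d - d'‖) := by
      rw [norm_smul, Real.norm_eq_abs]
      gcongr
    rw [h3] at h1
    have h6 := h1.trans (norm_sub_le _ _)
    linarith
  refine ⟨F, J, ⟨hFcd, ?_, hJ'sq, ⟨max r₁ (Real.exp κ⁻¹), fun y hy => ?_⟩,
    c / 2, by positivity, fun p d d' => ?_⟩, min (min 1 s) r, by positivity, min_le_right _ _,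
    fun y hy => hnear y (hy.trans_le (min_le_left _ _))⟩
  · rw [hnear 0 (by simpa using hs0), hf0]
  · have h1 : logCutoff κ 1 y = 1 := logCutoff_eq_one hκ0 one_pos (by
      rw [one_mul]; exact (le_max_right _ _).trans hy)
    have h2 : r₁ ≤ ‖y‖ := (le_max_left _ _).trans hy
    simp only [hF]
    rw [h1, hk0 y (by linarith), sub_apply]
    module
  · rcases le_total ‖d‖ ‖d'‖ with h | h
    · exact hFle p d d' h
    · have h1 := hFle p d' d h
      rw [norm_sub_rev, ← norm_neg (p.1 • (d' - d) + _)] at h1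
      refine h1.trans_eq (congrArg norm ?_)
      module

end Interpolation

/-! ### The germ of a fibration as a graph -/

section Germs

variable {n : ℕ}

/-- The base coordinate, in the local trivialization `Φ`, of the circle through the direction of
`z`. -/
def baseCoord (Φ : OpenPartialHomeomorph (EuclideanSpace ℝ (Fin (2 * n)) × Circle) (OddSphere n))
    (z : Ambient n) : EuclideanSpace ℝ (Fin (2 * n)) :=
  (Φ.symm (toSphere n z)).1

/-- The parametrization by angle of the circles of the local trivialization `Φ`. -/
def fibreCurve
    (Φ : OpenPartialHomeomorph (EuclideanSpace ℝ (Fin (2 * n)) × Circle) (OddSphere n))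
    (q : EuclideanSpace ℝ (Fin (2 * n)) × ℝ) : Ambient n :=
  Φ (q.1, Circle.exp q.2)

namespace IsSmoothLocalTrivialization

variable {𝓕 : Set (OrientedGreatCircle n)} {D : Set (EuclideanSpace ℝ (Fin (2 * n)))}
  {Φ : OpenPartialHomeomorph (EuclideanSpace ℝ (Fin (2 * n)) × Circle) (OddSphere n)}
  (h : IsSmoothLocalTrivialization 𝓕 D Φ)
include h

lemma mem_source {d} (hd : d ∈ D) (ζ : Circle) : (d, ζ) ∈ Φ.source := by
  rw [h.source_eq]; exact ⟨hd, trivial⟩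

lemma fst_mem {p} (hp : p ∈ Φ.source) : p.1 ∈ D := by
  rw [h.source_eq] at hp; exact hp.1

lemma contDiffAt_fibreCurve {q : EuclideanSpace ℝ (Fin (2 * n)) × ℝ} (hq : q.1 ∈ D) :
    ContDiffAt ℝ ∞ (fibreCurve Φ) q := by
  have h1 : ContMDiff 𝓘(ℝ, EuclideanSpace ℝ (Fin (2 * n)) × ℝ) ((𝓡 (2 * n)).prod (𝓡 1)) ∞
      fun q : EuclideanSpace ℝ (Fin (2 * n)) × ℝ => (q.1, Circle.exp q.2) :=
    (contDiff_fst.contMDiff).prodMk (contMDiff_circleExp.comp contDiff_snd.contMDiff)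
  have h2 : ContMDiffOn 𝓘(ℝ, EuclideanSpace ℝ (Fin (2 * n)) × ℝ) 𝓘(ℝ, Ambient n) ∞
      (fibreCurve Φ) {q | q.1 ∈ D} :=
    (contMDiff_coe_oddSphere n).comp_contMDiffOn
      (h.contMDiffOn.comp h1.contMDiffOn fun q hq => h.mem_source hq _)
  exact (contMDiffOn_iff_contDiffOn.1 h2).contDiffAt
    ((h.isOpen_base.preimage continuous_fst).mem_nhds hq)

lemma contDiffAt_baseCoord {z : Ambient n} (hz : z ≠ 0) (ht : toSphere n z ∈ Φ.target) :
    ContDiffAt ℝ ∞ (baseCoord Φ) z := by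
  have h1 : ContMDiffOn 𝓘(ℝ, Ambient n) (𝓡 (2 * n)) ∞ (baseCoord Φ)
      ({0}ᶜ ∩ toSphere n ⁻¹' Φ.target) :=
    contMDiff_fst.comp_contMDiffOn (h.contMDiffOn_symm.comp
      ((contMDiffOn_toSphere n).mono Set.inter_subset_left) fun z hz => hz.2)
  exact (contMDiffOn_iff_contDiffOn.1 h1).contDiffAt
    (((contMDiffOn_toSphere n).continuousOn.isOpen_inter_preimage isOpen_compl_singleton
      Φ.open_target).mem_nhds ⟨hz, ht⟩)

lemma baseCoord_mem {z : Ambient n} (ht : toSphere n z ∈ Φ.target) : baseCoord Φ z ∈ D :=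
  h.fst_mem (Φ.map_target ht)

/-- The circle of the family through a direction `z` in the domain of the trivialization. -/
lemma exists_circle {z : Ambient n} (hz : z ≠ 0) (ht : toSphere n z ∈ Φ.target) :
    ∃ C ∈ 𝓕, z ∈ C.plane ∧ ∀ t, fibreCurve Φ (baseCoord Φ z, t) ∈ C.plane ∧
      ∃ c : ℝ, 0 < c ∧ HasDerivAt (fun s => fibreCurve Φ (baseCoord Φ z, s))
        (c • C.unitTangent (fibreCurve Φ (baseCoord Φ z, t))) t := by
  obtain ⟨C, hC, hrange, hderiv⟩ := h.fibre _ (h.baseCoord_mem ht)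
  refine ⟨C, hC, ?_, fun t => ⟨?_, hderiv t⟩⟩
  · have h1 : toSphere n z ∈ C.carrier := by
      rw [← hrange]
      exact ⟨(Φ.symm (toSphere n z)).2, Φ.right_inv ht⟩
    have h2 : (toSphere n z : Ambient n) ∈ C.plane := h1
    rw [coe_toSphere hz] at h2
    exact (C.plane.smul_mem_iff (inv_ne_zero (norm_ne_zero_iff.2 hz))).1 h2
  · have h1 : Φ (baseCoord Φ z, Circle.exp t) ∈ C.carrier := by
      rw [← hrange]
      exact ⟨_, rfl⟩
    exact h1

end IsSmoothLocalTrivialization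

namespace PlaneFrame

variable (φ : PlaneFrame n)

/-- A plane containing the graph basis `e₁ + y, e₂ + z` is parametrized by its projection to the
plane of the frame. -/
lemma eq_comb_of_mem {C : OrientedGreatCircle n} {y z : EuclideanSpace ℝ (Fin (2 * n))}
    (hp : φ.e₁ + φ.ι y ∈ C.plane) (hq : φ.e₂ + φ.ι z ∈ C.plane) {w : Ambient n}
    (hw : w ∈ C.plane) : w = φ.a w • (φ.e₁ + φ.ι y) + φ.b w • (φ.e₂ + φ.ι z) := by
  have hli : LinearIndependent ℝ ![φ.e₁ + φ.ι y, φ.e₂ + φ.ι z] := by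
    rw [LinearIndependent.pair_iff]
    intro s t hst
    have h1 := congrArg φ.a hst
    have h2 := congrArg φ.b hst
    exact ⟨by simpa using h1, by simpa using h2⟩
  have hspan : Submodule.span ℝ {φ.e₁ + φ.ι y, φ.e₂ + φ.ι z} = C.plane := by
    apply Submodule.eq_of_le_of_finrank_eq
    · rw [Submodule.span_le]
      rintro x (rfl | rfl)
      exacts [hp, hq]
    · rw [C.finrank_plane, finrank_span_pair hli]
  rw [← hspan, Submodule.mem_span_pair] at hw
  obtain ⟨s, t, rfl⟩ := hw
  simp

end PlaneFrame

/-- Near one of its fibres `P`, a fibration consists of the planes `span(e₁ + y, e₂ + f y)`, for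
the germ of a smooth map `f`. The derivative of `f` at `0` has no real eigenvalue, because the
fibration is smoothly trivial: the parameter `y` is a smooth function of each of the points
`c • (e₁ + y) - (e₂ + f y)`. -/
lemma IsSmoothGreatCircleFibration.exists_graph_germ {P : OrientedGreatCircle n}
    {U : Set (OddSphere n)} {𝓕 : Set (OrientedGreatCircle n)}
    (h𝓕 : IsSmoothGreatCircleFibration 𝓕 U) (hP : P ∈ 𝓕) (φ : PlaneFrame n)
    (he₁ : φ.e₁ ∈ P.plane) (he₂ : φ.e₂ = P.unitTangent φ.e₁) :
    ∃ (f : EuclideanSpace ℝ (Fin (2 * n)) → EuclideanSpace ℝ (Fin (2 * n))) (r : ℝ), 0 < r ∧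
      ContDiffOn ℝ ∞ f (Metric.ball 0 r) ∧ f 0 = 0 ∧
      (∀ (c : ℝ) (v : EuclideanSpace ℝ (Fin (2 * n))), fderiv ℝ f 0 v = c • v → v = 0) ∧
      ∀ y, ‖y‖ < r → ∃ C ∈ 𝓕, C.IsPos (φ.e₁ + φ.ι y) (φ.e₂ + φ.ι (f y)) := by
  have he₂P : φ.e₂ ∈ P.plane := he₂ ▸ P.unitTangent_mem _
  have hne₁ : φ.e₁ ≠ 0 := fun h0 => by simpa [h0] using φ.inner_e₁_e₁
  have hne₂ : φ.e₂ ≠ 0 := fun h0 => by simpa [h0] using φ.inner_e₂_e₂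
  have hn₁ : ‖φ.e₁‖ = 1 := by rw [norm_eq_sqrt_real_inner, φ.inner_e₁_e₁, Real.sqrt_one]
  have hn₂ : ‖φ.e₂‖ = 1 := by rw [norm_eq_sqrt_real_inner, φ.inner_e₂_e₂, Real.sqrt_one]
  have hcarrier : ∀ {C : OrientedGreatCircle n} {z}, z ≠ 0 → z ∈ C.plane →
      toSphere n z ∈ C.carrier := by
    intro C z hz hzC
    change (toSphere n z : Ambient n) ∈ C.plane
    rw [coe_toSphere hz]
    exact C.plane.smul_mem _ hzC
  have hUnique : ∀ {C C' : OrientedGreatCircle n} {z}, z ≠ 0 → C ∈ 𝓕 → C' ∈ 𝓕 → z ∈ C.plane →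
      z ∈ C'.plane → C = C' := by
    intro C C' z hz hC hC' hzC hzC'
    exact (h𝓕.existsUnique_fibre _ (h𝓕.carrier_subset C hC (hcarrier hz hzC))).unique
      ⟨hC, hcarrier hz hzC⟩ ⟨hC', hcarrier hz hzC'⟩
  -- a trivialization near `e₁`; its domain contains all of `P`
  obtain ⟨D, Φ, h, hx₁⟩ := h𝓕.locally_trivial _ (h𝓕.carrier_subset P hP (hcarrier hne₁ he₁))
  set d₀ := baseCoord Φ φ.e₁ with hd₀
  have hd₀D : d₀ ∈ D := h.baseCoord_mem hx₁
  obtain ⟨C, hC, hrange, hderiv⟩ := h.fibre d₀ hd₀D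
  obtain rfl : C = P := by
    have h1 : toSphere n φ.e₁ ∈ C.carrier := by
      rw [← hrange]
      exact ⟨(Φ.symm (toSphere n φ.e₁)).2, Φ.right_inv hx₁⟩
    exact (h𝓕.existsUnique_fibre _ (h𝓕.carrier_subset C hC h1)).unique ⟨hC, h1⟩
      ⟨hP, hcarrier hne₁ he₁⟩
  have hangle : ∀ z, z ∈ C.plane → z ≠ 0 →
      ∃ t, Φ (d₀, Circle.exp t) = toSphere n z := by
    intro z hz hz0
    have h1 := hcarrier hz0 hz
    rw [← hrange] at h1
    obtain ⟨ζ, hζ⟩ := h1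
    obtain ⟨t, rfl⟩ := Circle.exp_surjective ζ
    exact ⟨t, hζ⟩
  have htarget : ∀ z, z ∈ C.plane → z ≠ 0 → toSphere n z ∈ Φ.target ∧ baseCoord Φ z = d₀ := by
    intro z hz hz0
    obtain ⟨t, ht⟩ := hangle z hz hz0
    refine ⟨ht ▸ Φ.map_source (h.mem_source hd₀D _), ?_⟩
    rw [baseCoord, ← ht, Φ.left_inv (h.mem_source hd₀D _)]
  obtain ⟨t₁, ht₁⟩ := hangle _ he₁ hne₁
  obtain ⟨t₂, ht₂⟩ := hangle _ he₂P hne₂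
  have hcurve₁ : fibreCurve Φ (d₀, t₁) = φ.e₁ := by
    rw [fibreCurve, ht₁, coe_toSphere hne₁, hn₁, inv_one, one_smul]
  have hcurve₂ : fibreCurve Φ (d₀, t₂) = φ.e₂ := by
    rw [fibreCurve, ht₂, coe_toSphere hne₂, hn₂, inv_one, one_smul]
  have hcurve : ∀ t z, z ≠ 0 → toSphere n z ∈ Φ.target →
      ContDiffAt ℝ ∞ (fun z => fibreCurve Φ (baseCoord Φ z, t)) z := fun t z hz hzt =>
    ContDiffAt.comp (g := fibreCurve Φ) (f := fun z => (baseCoord Φ z, t)) z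
      (h.contDiffAt_fibreCurve (q := (baseCoord Φ z, t)) (h.baseCoord_mem hzt))
      ((h.contDiffAt_baseCoord hz hzt).prodMk contDiffAt_const)
  have htarget_nhds : ∀ z, z ∈ C.plane → z ≠ 0 →
      ∀ᶠ z' in nhds z, z' ≠ 0 ∧ toSphere n z' ∈ Φ.target := by
    intro z hz hz0
    exact (((contMDiffOn_toSphere n).continuousOn.isOpen_inter_preimage isOpen_compl_singleton
      Φ.open_target).mem_nhds ⟨hz0, (htarget z hz hz0).1⟩)
  -- the graph map
  set p : EuclideanSpace ℝ (Fin (2 * n)) → Ambient n := fun y => φ.e₁ + φ.ι y with hp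
  have hpcd : ContDiff ℝ ∞ p := contDiff_const.add φ.ι.contDiff
  have hp0 : p 0 = φ.e₁ := by simp [hp]
  set A : EuclideanSpace ℝ (Fin (2 * n)) → Ambient n :=
    fun y => fibreCurve Φ (baseCoord Φ (p y), t₂) with hA
  have hA0 : A 0 = φ.e₂ := by simp only [hA, hp0]; exact hcurve₂
  set f : EuclideanSpace ℝ (Fin (2 * n)) → EuclideanSpace ℝ (Fin (2 * n)) :=
    fun y => (φ.b (A y))⁻¹ • (φ.π (A y) - φ.a (A y) • y) with hf
  have hf0 : f 0 = 0 := by simp [hf, hA0]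
  -- the velocity of the circles at angle `t₁`, and the determinant that measures its direction
  set vel : EuclideanSpace ℝ (Fin (2 * n)) → Ambient n :=
    fun d => fderiv ℝ (fibreCurve Φ) (d, t₁) (0, 1) with hvel
  have hvelcont : ContinuousAt vel d₀ := by
    have h1 : ContinuousAt (fderiv ℝ (fibreCurve Φ)) (d₀, t₁) :=
      ((h.contDiffAt_fibreCurve (q := (d₀, t₁)) hd₀D).fderiv_right (m := 0) (by simp)).continuousAt
    have h2 : ContinuousAt (fun d => fderiv ℝ (fibreCurve Φ) (d, t₁)) d₀ :=
      ContinuousAt.comp (f := fun d => (d, t₁)) (g := fderiv ℝ (fibreCurve Φ)) h1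
        (Continuous.prodMk_left t₁).continuousAt
    exact h2.clm_apply continuousAt_const
  have hveleq : ∀ d ∈ D, ∀ v, HasDerivAt (fun s => fibreCurve Φ (d, s)) v t₁ → v = vel d := by
    intro d hd v hv
    have h1 : HasFDerivAt (fibreCurve Φ) _ (d, t₁) :=
      ((h.contDiffAt_fibreCurve (q := (d, t₁)) hd).differentiableAt (by simp)).hasFDerivAt
    have h2 : HasDerivAt (fun s : ℝ => (d, s)) ((0, 1) : EuclideanSpace ℝ (Fin (2 * n)) × ℝ) t₁ :=
      (hasDerivAt_const t₁ d).prodMk (hasDerivAt_id t₁)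
    exact hv.unique (h1.comp_hasDerivAt t₁ h2)
  set Q : EuclideanSpace ℝ (Fin (2 * n)) → ℝ := fun d =>
    φ.a (fibreCurve Φ (d, t₁)) * φ.b (vel d) - φ.b (fibreCurve Φ (d, t₁)) * φ.a (vel d) with hQ
  have hQcont : ContinuousAt Q d₀ := by
    have h1 : ContinuousAt (fun d => fibreCurve Φ (d, t₁)) d₀ :=
      ContinuousAt.comp (f := fun d => (d, t₁)) (g := fibreCurve Φ)
        (h.contDiffAt_fibreCurve (q := (d₀, t₁)) hd₀D).continuousAt
        (Continuous.prodMk_left t₁).continuousAt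
    have ha := φ.contDiff_a.continuous
    have hb := φ.contDiff_b.continuous
    exact ((ha.continuousAt.comp h1).mul (hb.continuousAt.comp hvelcont)).sub
      ((hb.continuousAt.comp h1).mul (ha.continuousAt.comp hvelcont))
  -- the fibre over `d₀` is `P`, whose velocity at `e₁` is a positive multiple of `e₂`
  have hQ0 : 0 < Q d₀ := by
    obtain ⟨c, hc, hcd⟩ := hderiv t₁
    have h1 := hveleq d₀ hd₀D _ hcd
    change c • C.unitTangent (fibreCurve Φ (d₀, t₁)) = _ at h1
    rw [hcurve₁, ← he₂] at h1
    simp only [hQ]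
    rw [hcurve₁, ← h1]
    simpa using hc
  have hbase0 : ContinuousAt (fun y => baseCoord Φ (p y)) 0 := by
    refine ContinuousAt.comp (f := p) (g := baseCoord Φ) ?_ hpcd.continuous.continuousAt
    rw [hp0]
    exact (h.contDiffAt_baseCoord hne₁ hx₁).continuousAt
  have hpev : ∀ᶠ y in nhds 0, p y ≠ 0 ∧ toSphere n (p y) ∈ Φ.target :=
    (hpcd.continuous.tendsto' 0 _ hp0).eventually (htarget_nhds _ he₁ hne₁)
  have hAcd : ∀ y, p y ≠ 0 ∧ toSphere n (p y) ∈ Φ.target → ContDiffAt ℝ ∞ A y := fun y hy =>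
    ContDiffAt.comp (g := fun z => fibreCurve Φ (baseCoord Φ z, t₂)) y
      (hcurve t₂ (p y) hy.1 hy.2) hpcd.contDiffAt
  have hAcd0 : ContDiffAt ℝ ∞ A 0 := hAcd 0 hpev.self_of_nhds
  have hbev : ∀ᶠ y in nhds 0, 0 < φ.b (A y) :=
    (φ.contDiff_b.continuous.continuousAt.comp hAcd0.continuousAt).eventually
      (lt_mem_nhds (by simp [hA0]))
  have hQev : ∀ᶠ y in nhds 0, 0 < Q (baseCoord Φ (p y)) := by
    have h1 : baseCoord Φ (p 0) = d₀ := by rw [hp0]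
    have h2 : ContinuousAt (fun y => Q (baseCoord Φ (p y))) 0 :=
      ContinuousAt.comp (f := fun y => baseCoord Φ (p y)) (g := Q) (h1 ▸ hQcont) hbase0
    have h3 : 0 < Q (baseCoord Φ (p 0)) := by rwa [h1]
    exact h2.eventually (lt_mem_nhds h3)
  obtain ⟨r, hr, hball⟩ := Metric.eventually_nhds_iff_ball.1 (hpev.and (hbev.and hQev))
  have hfcd : ∀ y ∈ Metric.ball 0 r, ContDiffAt ℝ ∞ f y := by
    intro y hy
    obtain ⟨hy1, hy2, -⟩ := hball y hy
    have h1 := hAcd y hy1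
    exact ((φ.contDiff_b.contDiffAt.comp y h1).inv hy2.ne').smul
      ((φ.π.contDiff.contDiffAt.comp y h1).sub
        ((φ.contDiff_a.contDiffAt.comp y h1).smul contDiffAt_id))
  have hgraph : ∀ y, ‖y‖ < r → ∃ C ∈ 𝓕, C.IsPos (p y) (φ.e₂ + φ.ι (f y)) := by
    intro y hy
    obtain ⟨hy1, hy2, hy3⟩ := hball y (by simpa using hy)
    obtain ⟨C', hC', hpC', hcurveC'⟩ := h.exists_circle hy1.1 hy1.2
    have hAC' : A y ∈ C'.plane := (hcurveC' t₂).1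
    have hqC' : φ.e₂ + φ.ι (f y) ∈ C'.plane := by
      have h1 : φ.e₂ + φ.ι (f y) = (φ.b (A y))⁻¹ • (A y - φ.a (A y) • p y) := by
        apply φ.ext_coords
        · simp [hp]
        · simp [hp, hy2.ne']
        · simp [hp, hf]
      rw [h1]
      exact C'.plane.smul_mem _ (C'.plane.sub_mem hAC' (C'.plane.smul_mem _ hpC'))
    refine ⟨C', hC', (C'.isPos_iff _ _).2 ⟨hpC', hqC', ?_⟩⟩
    obtain ⟨hwC', c, hc, hcd⟩ := hcurveC' t₁
    have h1 := hveleq _ (h.baseCoord_mem hy1.2) _ hcd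
    simp only [hQ] at hy3
    rw [← h1] at hy3
    set w := fibreCurve Φ (baseCoord Φ (p y), t₁) with hw
    have hw1 : ‖w‖ = 1 := by rw [hw, fibreCurve]; simp
    have hvC' : c • C'.unitTangent w ∈ C'.plane := C'.plane.smul_mem _ (C'.unitTangent_mem _)
    have h2 := ((C'.isPos_iff _ _).1 (C'.isPos_unitTangent hwC'
      (norm_ne_zero_iff.1 (by rw [hw1]; exact one_ne_zero)))).2.2
    have h3 : ∀ v ∈ C'.plane, C'.area w v =
        (φ.a w * φ.b v - φ.b w * φ.a v) * C'.area (p y) (φ.e₂ + φ.ι (f y)) := fun v hv => by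
      rw [← C'.area_comb, ← φ.eq_comb_of_mem hpC' hqC' hwC', ← φ.eq_comb_of_mem hpC' hqC' hv]
    have h4 : 0 < C'.area w (c • C'.unitTangent w) := by
      have := C'.area_comb w (C'.unitTangent w) 1 0 0 c
      rw [one_smul, zero_smul, zero_smul, add_zero, zero_add] at this
      rw [this, one_mul, zero_mul, sub_zero]
      positivity
    rw [h3 _ hvC'] at h4
    exact (pos_iff_pos_of_mul_pos h4).1 hy3
  refine ⟨f, r, hr, fun y hy => (hfcd y hy).contDiffWithinAt, hf0, fun c v hv => ?_, hgraph⟩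
  -- a smooth left inverse of `y ↦ c • (e₁ + y) - (e₂ + f y)` near `0`
  set m : EuclideanSpace ℝ (Fin (2 * n)) → Ambient n :=
    fun y => c • p y - (φ.e₂ + φ.ι (f y)) with hm
  have hfd : HasFDerivAt f (fderiv ℝ f 0) 0 :=
    ((hfcd 0 (Metric.mem_ball_self hr)).differentiableAt (by simp)).hasFDerivAt
  have hmd : HasFDerivAt m (c • φ.ι - φ.ι ∘L fderiv ℝ f 0) 0 :=
    ((φ.ι.hasFDerivAt.const_add φ.e₁).const_smul c).sub
      ((φ.ι.hasFDerivAt.comp 0 hfd).const_add φ.e₂)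
  have hm0 : m 0 = c • φ.e₁ - φ.e₂ := by simp [hm, hp0, hf0]
  have hm0C : m 0 ∈ C.plane := hm0 ▸ C.plane.sub_mem (C.plane.smul_mem _ he₁) he₂P
  have hm0ne : m 0 ≠ 0 := fun h0 => by
    have := congrArg φ.b (hm0.symm.trans h0)
    simp at this
  obtain ⟨hm0t, hm0d⟩ := htarget _ hm0C hm0ne
  set w₁ : Ambient n → Ambient n := fun z => fibreCurve Φ (baseCoord Φ z, t₁) with hw₁
  set w₂ : Ambient n → Ambient n := fun z => fibreCurve Φ (baseCoord Φ z, t₂) with hw₂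
  have hw₁0 : w₁ (m 0) = φ.e₁ := by simp only [hw₁, hm0d, hcurve₁]
  have hw₂0 : w₂ (m 0) = φ.e₂ := by simp only [hw₂, hm0d, hcurve₂]
  have hw₁d := hcurve t₁ _ hm0ne hm0t
  have hw₂d := hcurve t₂ _ hm0ne hm0t
  set det : Ambient n → ℝ := fun z => φ.a (w₁ z) * φ.b (w₂ z) - φ.b (w₁ z) * φ.a (w₂ z) with hdet
  have hdet0 : det (m 0) ≠ 0 := by simp [hdet, hw₁0, hw₂0]
  have hdetd : ContDiffAt ℝ ∞ det (m 0) :=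
    ((φ.contDiff_a.contDiffAt.comp _ hw₁d).mul (φ.contDiff_b.contDiffAt.comp _ hw₂d)).sub
      ((φ.contDiff_b.contDiffAt.comp _ hw₁d).mul (φ.contDiff_a.contDiffAt.comp _ hw₂d))
  set Ψ : Ambient n → EuclideanSpace ℝ (Fin (2 * n)) := fun z =>
    (det z)⁻¹ • φ.π (φ.b (w₂ z) • w₁ z - φ.b (w₁ z) • w₂ z) with hΨ
  have hΨd : ContDiffAt ℝ ∞ Ψ (m 0) :=
    (hdetd.inv hdet0).smul (φ.π.contDiff.contDiffAt.comp _
      (((φ.contDiff_b.contDiffAt.comp _ hw₂d).smul hw₁d).sub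
        ((φ.contDiff_b.contDiffAt.comp _ hw₁d).smul hw₂d)))
  have hinv : ∀ᶠ y in nhds 0, Ψ (m y) = y := by
    have hmc : ContinuousAt m 0 := hmd.continuousAt
    filter_upwards [hmc.eventually (htarget_nhds _ hm0C hm0ne),
      hmc.eventually (hdetd.continuousAt.eventually_ne hdet0),
      Metric.ball_mem_nhds 0 hr] with y hy1 hy2 hy3
    obtain ⟨C', hC', hpos⟩ := hgraph y (by simpa using hy3)
    obtain ⟨C'', hC'', hmC'', hcurveC''⟩ := h.exists_circle hy1.1 hy1.2
    have hmC' : m y ∈ C'.plane := C'.plane.sub_mem (C'.plane.smul_mem _ hpos.1) hpos.2.1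
    obtain rfl : C'' = C' := hUnique hy1.1 hC'' hC' hmC'' hmC'
    have h1 := φ.eq_comb_of_mem hpos.1 hpos.2.1 (hcurveC'' t₁).1
    have h2 := φ.eq_comb_of_mem hpos.1 hpos.2.1 (hcurveC'' t₂).1
    have h3 : φ.b (w₂ (m y)) • w₁ (m y) - φ.b (w₁ (m y)) • w₂ (m y) = det (m y) • p y := by
      simp only [hdet]
      change w₁ (m y) = _ at h1
      change w₂ (m y) = _ at h2
      generalize φ.a (w₁ (m y)) = a₁ at *
      generalize φ.b (w₁ (m y)) = b₁ at *
      generalize φ.a (w₂ (m y)) = a₂ at *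
      generalize φ.b (w₂ (m y)) = b₂ at *
      rw [h1, h2]
      simp only [hp]
      module
    simp only [hΨ]
    rw [h3, map_smul, smul_smul, inv_mul_cancel₀ hy2, one_smul]
    simp [hp]
  have hcomp : HasFDerivAt (fun y => Ψ (m y)) _ 0 :=
    (hΨd.differentiableAt (by simp)).hasFDerivAt.comp 0 hmd
  have hid := (hcomp.congr_of_eventuallyEq (hinv.mono fun y hy => hy.symm)).unique
    (hasFDerivAt_id (0 : EuclideanSpace ℝ (Fin (2 * n))))
  have h1 := congrArg (fun L => L v) hid
  simp only [ContinuousLinearMap.comp_apply, sub_apply, smul_apply, hv,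
    map_smul, sub_self, map_zero] at h1
  exact h1.symm

end Germs

end

/-! ### The extension theorem -/

theorem theoremB (n : ℕ) (P : OrientedGreatCircle n) (U : Set (OddSphere n))
    (𝓕 : Set (OrientedGreatCircle n)) (h𝓕 : IsSmoothGreatCircleFibration 𝓕 U) (hP : P ∈ 𝓕) :
    ∃ 𝓖 : Set (OrientedGreatCircle n),
      IsSmoothGreatCircleFibration 𝓖 Set.univ ∧ P ∈ 𝓖 ∧ AgreeNear P 𝓕 U 𝓖 Set.univ := by
  obtain ⟨u, hu, hu1⟩ : ∃ u ∈ P.plane, ‖u‖ = 1 := by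
    have : Nontrivial P.plane := Module.nontrivial_of_finrank_pos (R := ℝ) (by
      rw [P.finrank_plane]; norm_num)
    obtain ⟨u, hu⟩ := exists_norm_eq P.plane zero_le_one
    exact ⟨u, u.2, hu⟩
  obtain ⟨φ, he₁, he₂⟩ := P.exists_frame hu hu1
  have he₁P : φ.e₁ ∈ P.plane := he₁ ▸ hu
  have he₂P : φ.e₂ = P.unitTangent φ.e₁ := he₁ ▸ he₂
  obtain ⟨f, r, hr, hfcd, hf0, hT, hgraph⟩ := h𝓕.exists_graph_germ hP φ he₁P he₂P
  obtain ⟨F, J, hF, r', hr', hr'r, hFf⟩ := exists_isUniformlyTransverse hr hfcd hf0 hT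
  have hX := φ.isQuarterTurnField_graphField hF
  have hPpos : P.IsPos φ.e₁ φ.e₂ := by
    rw [he₂P]
    exact P.isPos_unitTangent he₁P (fun h0 => by simpa [h0] using φ.inner_e₁_e₁)
  have hP𝓖 : P ∈ fibresOf (φ.graphField F J) := by
    refine ⟨φ.e₁, fun h0 => by simpa [h0] using φ.inner_e₁_e₁, ?_⟩
    have h1 := φ.graphField_comb hF (1, 0) 0
    simp only [one_smul, zero_smul, add_zero, sub_zero, map_zero, hF.map_zero] at h1
    rwa [h1]
  have hab : ∀ x ∈ P.plane, x ≠ 0 → φ.ab x ≠ 0 ∧ φ.param F x = 0 := by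
    intro x hx hx0
    obtain ⟨s, t, rfl⟩ := hPpos.exists_comb hx
    have hst : ((s, t) : ℝ × ℝ) ≠ 0 := fun h0 => hx0 (by
      rw [show s = 0 from congrArg Prod.fst h0, show t = 0 from congrArg Prod.snd h0]
      simp)
    constructor
    · simpa [PlaneFrame.ab] using hst
    · have := φ.param_comb hF hst 0
      simpa [hF.map_zero] using this
  set W : Set (OddSphere n) := {x | φ.ab x ≠ 0 ∧ ‖φ.param F x‖ < r'} with hW
  -- near `P`, the circles of the extension belong to `𝓕`
  have hW𝓕 : ∀ x ∈ W, ∀ C ∈ fibresOf (φ.graphField F J), x ∈ C.carrier → C ∈ 𝓕 := by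
    rintro x ⟨hx, hxr⟩ C hC hxC
    have h1 := φ.isPos_of_mem_fibresOf_graphField hF hC hxC hx
    rw [hFf _ hxr] at h1
    obtain ⟨C', hC', h2⟩ := hgraph _ (hxr.trans_le hr'r)
    rwa [h1.unique h2]
  have hWU : W ⊆ U := by
    intro x hx
    obtain ⟨C, ⟨hC, hxC⟩, -⟩ := hX.existsUnique_fibre x
    exact h𝓕.carrier_subset C (hW𝓕 x hx C hC hxC) hxC
  refine ⟨fibresOf (φ.graphField F J), hX.isSmoothGreatCircleFibration, hP𝓖, W, ?_, ?_, hWU,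
    Set.subset_univ _, ?_⟩
  · rw [isOpen_iff_mem_nhds]
    rintro x ⟨hx, hxr⟩
    have h1 : ContinuousAt (fun x : OddSphere n => φ.ab x) x :=
      (φ.contDiff_ab.continuous.comp continuous_subtype_val).continuousAt
    have h2 : ContinuousAt (fun x : OddSphere n => ‖φ.param F x‖) x :=
      (ContinuousAt.comp (φ.contDiffAt_param hF hx).continuousAt
        continuous_subtype_val.continuousAt).norm
    exact (h1.eventually_ne hx).and (h2.eventually_lt_const hxr)
  · intro x hx
    obtain ⟨h1, h2⟩ := hab x hx (ne_zero_of_mem_unit_sphere x)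
    exact ⟨h1, by rw [h2, norm_zero]; exact hr'⟩
  · intro x hx C hxC
    refine ⟨fun hC => ?_, fun hC => hW𝓕 x hx C hC hxC⟩
    obtain ⟨C', ⟨hC', hxC'⟩, -⟩ := hX.existsUnique_fibre x
    have := (h𝓕.existsUnique_fibre x (hWU hx)).unique ⟨hC, hxC⟩ ⟨hW𝓕 x hx C' hC' hxC', hxC'⟩
    rwa [this]
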